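/- **Theorem 5.** Let $D\ge 4$ be an integer and $\alpha\in(0,\tfrac14]$. Let the set of arms be the unit sphere $\mathcal A=\{x\in\mathbb R^D:\|x\|_2=1\}$, let the outcome set be $$\mathcal D=\Big\{y\in\mathbb R^{D+2}: y_0+y_1=1,\ y_0\ge 0,\ y_1\ge 0,\ y_1^2\ge\sum_{i=2}^{D+1}y_i^2\Big\},$$ let the reward be $r(x,y)=\sum_{i<D}x_iy_{i+2}$, and let the hypothesis set be $$\mathcal H=\Big\{(1-\alpha,\,-\alpha,\,2\alpha u)\in\mathbb R^{D+2}: u\in\mathbb R^D,\ \|u\|_2=1\Big\}.$$ For $\theta\in\mathcal H$ and $x\in\mathcal A$ let $H_\theta(x)$ be the set of probability distributions $\zeta$ on $\mathcal D$ whose expected value $\mathrm E_{y\sim\zeta}[y]$ (a point of $\mathcal D$) satisfies $\theta^{\mathsf T}\,\mathrm E_{y\sim\zeta}[y]=0$. An agent policy is a Borel measurable map $\varphi:(\mathcal A\times\mathcal D)^*\to\mathcal A$. A nature policy compatible with $\theta$ is a Markov kernel $\nu$ from $(\mathcal A\times\mathcal D)^*\times\mathcal A$ to $\mathcal D$ with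 $\nu(hx)\in H_\theta(x)$ for all $h,x$. The two generate a random sequence by $x_n=\varphi(x_0y_0\ldots x_{n-1}y_{n-1})$ and $y_n\sim\nu(x_0y_0\ldots x_{n-1}y_{n-1}x_n)$. The expected regret at horizon $N$ is $$\mathrm{ERg}_\theta(\varphi;N)=N\cdot\sup_{x\in\mathcal A}\ \inf_{\zeta\in H_\theta(x)}\mathrm E_{y\sim\zeta}[r(x,y)]\;-\;\inf_{\nu}\ \sum_{n=0}^{N-1}\mathrm E_{\varphi\nu}[r(x_n,y_n)],$$ where $\nu$ runs over the nature policies compatible with $\theta$. Let $\xi$ be the uniform distribution on the sphere $\mathcal H$. Then for every agent policy $\varphi$ and every integer $N>0$, $$\mathrm E_{\theta\sim\xi}\big[\mathrm{ERg}_\theta(\varphi;N)\big]\ \ge\ \frac{2}{\pi^2}\left(1-\frac{1}{\sqrt{\pi(2D-1)}}\right)\left(\frac{1-\alpha}{1+2\alpha}\right)^{N}N^{\frac{D-3}{D-1}}-\frac12 .$$ In particular, there is an absolute constant $c>0$ such that, for all $D\ge4$, $\alpha\in(0,\tfrac14]$, $N>0$ and $\varphi$ as above, $$\mathrm E_{\theta\sim\xi}\big[\mathrm{ERg}_\theta(\varphi;N)\big]\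 \ge\ c\,e^{-3\alpha N}N^{\frac{D-3}{D-1}} .$$ (Expectation over $\theta$ is understood as the lower integral, the supremum of $\mathrm E_{\theta\sim\xi}[g(\theta)]$ over integrable $g\le\mathrm{ERg}_{\cdot}(\varphi;N)$; it is the ordinary expectation whenever the regret is $\xi$-integrable in $\theta$.) -/

import Mathlib

open MeasureTheory ProbabilityTheory
open scoped ENNReal

/-! ### Imprecise bandits: policies, induced distributions, regret

`A` is the space of arms and `O` the space of outcomes. A hypothesis assigns to every arm a set of
probability distributions on outcomes. -/

namespace ImpreciseBandit

noncomputable section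

/-- A history of `n` rounds, `x₀ y₀ … xₙ₋₁ yₙ₋₁`. -/
abbrev History (A O : Type*) (n : ℕ) : Type _ := Fin n → A × O

/-- A (deterministic, Borel measurable) agent policy `φ : (A × O)^* → A`. -/
structure AgentPolicy (A O : Type*) [MeasurableSpace A] [MeasurableSpace O] where
  act : ∀ n : ℕ, History A O n → A
  measurable_act : ∀ n, Measurable (act n)

/-- A nature policy compatible with the hypothesis `H`: a Markov kernel
`ν : (A × O)^* × A → Δ O` such that `ν(hx) ∈ H(x)` for all `h` and `x`. -/
structure NaturePolicy {A O : Type*} [MeasurableSpace A] [MeasurableSpace O]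
    (H : A → Set (Measure O)) where
  kernel : ∀ n : ℕ, Kernel (History A O n × A) O
  isMarkovKernel : ∀ n, IsMarkovKernel (kernel n)
  compatible : ∀ n (h : History A O n) (x : A), kernel n (h, x) ∈ H x

variable {A O : Type*} [MeasurableSpace A] [MeasurableSpace O] {H : A → Set (Measure O)}

/-- The conditional distribution of round `n`, given the history `h` of the previous rounds:
`xₙ = φ(h)` and `yₙ ∼ ν(h xₙ)`. -/
def roundKernel (φ : AgentPolicy A O) (ν : NaturePolicy H) (n : ℕ) :
    Kernel (History A O n) (A × O) :=
  Kernel.deterministic (φ.act n) (φ.measurable_act n) ⊗ₖ ν.kernel n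

/-- The distribution of the history of the first `n` rounds, when the agent follows `φ` and
nature follows `ν` (the marginal of `φν` on the first `n` rounds). -/
def historyLaw (φ : AgentPolicy A O) (ν : NaturePolicy H) : ∀ n : ℕ, Measure (History A O n)
  | 0 => Measure.dirac Fin.elim0
  | n + 1 => (historyLaw φ ν n ⊗ₘ roundKernel φ ν n).map
      (fun p => (Fin.snoc p.1 p.2 : History A O (n + 1)))

/-- The expected reward of round `n`. -/
def expectedReward (r : A → O → ℝ) (φ : AgentPolicy A O) (ν : NaturePolicy H) (n : ℕ) : ℝ :=
  ∫ h, r (h (Fin.last n)).1 (h (Fin.last n)).2 ∂(historyLaw φ ν (n + 1))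

/-- The lower prevision (minimal expected reward) of the arm `x` under the hypothesis `H`. -/
def lowerPrevision (H : A → Set (Measure O)) (r : A → O → ℝ) (x : A) : ℝ :=
  sInf ((fun ζ : Measure O => ∫ y, r x y ∂ζ) '' H x)

/-- The expected regret at time horizon `N`: `N` times the lower prevision of the best arm, minus
the expected total reward when nature plays the worst compatible policy. -/
def regret (H : A → Set (Measure O)) (r : A → O → ℝ) (φ : AgentPolicy A O) (N : ℕ) : ℝ :=
  N * (⨆ x, lowerPrevision H r x)
    - ⨅ ν : NaturePolicy H, ∑ n ∈ Finset.range N, expectedReward r φ ν n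

/-- For a subspace `U` and an outcome set `𝒟`, the credal set of all probability distributions
on `𝒟` with expected value in `U ∩ 𝒟`. -/
def credalSet {Y : Type*} [NormedAddCommGroup Y] [NormedSpace ℝ Y] [MeasurableSpace Y]
    (𝒟 : Set Y) (U : Submodule ℝ Y) : Set (Measure 𝒟) :=
  {ζ | IsProbabilityMeasure ζ ∧ ∫ y, (y : Y) ∂ζ ∈ (U : Set Y) ∩ 𝒟}

/-- The (lower) expectation of `f` under `ξ`, i.e. the supremum of the expectations of the
integrable functions below `f`. It equals `∫ θ, f θ ∂ξ` for every integrable `f`, see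
`lowerExpectation_eq_integral`, and a lower bound for it needs no measurability of `f`. -/
def lowerExpectation {Ω : Type*} [MeasurableSpace Ω] (ξ : Measure Ω) (f : Ω → ℝ) : EReal :=
  ⨆ (g : Ω → ℝ) (_ : Integrable g ξ) (_ : ∀ θ, g θ ≤ f θ), ((∫ θ, g θ ∂ξ : ℝ) : EReal)

theorem lowerExpectation_eq_integral {Ω : Type*} [MeasurableSpace Ω] (ξ : Measure Ω) (f : Ω → ℝ)
    (hf : Integrable f ξ) : lowerExpectation ξ f = ((∫ θ, f θ ∂ξ : ℝ) : EReal) := by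
  apply le_antisymm
  · refine iSup_le fun g => iSup_le fun hg => iSup_le fun hgf => ?_
    exact EReal.coe_le_coe_iff.2 (integral_mono hg hf hgf)
  · exact le_iSup_of_le f (le_iSup_of_le hf (le_iSup_of_le (fun _ => le_rfl) le_rfl))

end

end ImpreciseBandit

/-! ### The family of bandits -/

namespace ConeBandit

open ImpreciseBandit

noncomputable section

/-- The space of arms, the unit sphere of `ℝ^D`. -/
abbrev Arm (D : ℕ) : Type := Metric.sphere (0 : EuclideanSpace ℝ (Fin D)) 1

/-- The space `𝒴 = ℝ^(D+2)`; the space `𝒵` of parameters of hypotheses is `ℝ^(D+2)` as well. -/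
abbrev Y (D : ℕ) : Type := EuclideanSpace ℝ (Fin (D + 2))

/-- The outcome set, a cone over the `D`-dimensional unit ball:
`y₀ + y₁ = 1`, `y₀ ≥ 0`, `y₁ ≥ 0` and `y₁² ≥ y₂² + … + y_{D+1}²`. -/
def outcomeSet (D : ℕ) : Set (Y D) :=
  {y | y 0 + y 1 = 1 ∧ 0 ≤ y 0 ∧ 0 ≤ y 1 ∧ ∑ i : Fin D, (y i.succ.succ) ^ 2 ≤ (y 1) ^ 2}

/-- The parameter vector `(1 - α, -α, 2αu)`. -/
def paramVec {D : ℕ} (α : ℝ) (u : EuclideanSpace ℝ (Fin D)) : Y D :=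
  WithLp.toLp 2 (Matrix.vecCons (1 - α) (Matrix.vecCons (-α) fun i => 2 * α * u i))

/-- The hypothesis set `{(1 - α, -α, 2αu) : ‖u‖ = 1}`. -/
def hypothesisSet (D : ℕ) (α : ℝ) : Set (Y D) :=
  {θ | ∃ u : EuclideanSpace ℝ (Fin D), ‖u‖ = 1 ∧ θ = paramVec α u}

/-- The reward `r(x, y) = ∑_{i < D} xᵢ y_{i+2}`. -/
def reward (D : ℕ) (x : Arm D) (y : outcomeSet D) : ℝ :=
  ∑ i : Fin D, (x : EuclideanSpace ℝ (Fin D)) i * (y : Y D) i.succ.succ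

/-- `F(x, z, y) = zᵀ y`, as a linear functional of `y`. -/
def F (D : ℕ) (_x : Arm D) (z : Y D) : Y D →ₗ[ℝ] ℝ := innerₛₗ ℝ z

/-- The hypothesis with parameter `θ`: the credal set of the arm `x` consists of the distributions
of outcomes with expected value in `ker F(x, θ, ·)`. -/
def hypothesis (D : ℕ) (θ : Y D) (x : Arm D) : Set (Measure (outcomeSet D)) :=
  credalSet (outcomeSet D) (LinearMap.ker (F D x θ))

/-- The uniform probability distribution on the unit sphere of `ℝ^D`: the normalized surface
measure. -/
def uniformSphere (D : ℕ) : Measure (Metric.sphere (0 : EuclideanSpace ℝ (Fin D)) 1) :=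
  ((volume : Measure (EuclideanSpace ℝ (Fin D))).toSphere Set.univ)⁻¹ •
    (volume : Measure (EuclideanSpace ℝ (Fin D))).toSphere

/-- The uniform prior on the hypothesis set, which is a `(D - 1)`-dimensional sphere. -/
def prior (D : ℕ) (α : ℝ) : Measure (hypothesisSet D α) :=
  (uniformSphere D).map fun u => ⟨paramVec α u.1, u.1, mem_sphere_zero_iff_norm.1 u.2, rfl⟩

/-- The Bayesian expected regret `E_{θ ∼ ξ} [ERg_θ(φ; N)]` under the uniform prior `ξ`. -/
def bayesRegret (D : ℕ) (α : ℝ) (φ : AgentPolicy (Arm D) (outcomeSet D)) (N : ℕ) : EReal :=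
  lowerExpectation (prior D α) fun θ => regret (hypothesis D (θ : Y D)) (reward D) φ N

end

end ConeBandit

/-! ### The measure of a spherical cap -/

namespace ConeBandit

open Set Metric
open scoped Pointwise

/-! Write a mean outcome as `(y₀, y₁, v)`. Since `y₀ + y₁ = 1`, the constraint given by `u` reads
`y₀ = α(1 - 2⟨u, v⟩)`. As `y₀ ≥ 0`, this forces `⟨u, v⟩ ≤ 1/2`, so the arm `-u` guarantees reward
`-1/2` (`neg_half_le_iSup_lowerPrevision`). It remains to find a nature policy that holds the agent
below `-1/2` while hiding `u`.

Nature answers `x` by the apex with probability `p`, and otherwise by one of the rim points `±x`,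
with conditional mean `-m x` for a fixed `m` slightly above `1/2`. Only `p` depends on `u`, so the
agent learns nothing until the apex appears or an arm falls into the cap around `-u` where `1 +
2m⟨u, x⟩ < 0` and no valid `p` exists. From then on nature plays a safe answer, worth at most
`-1/2`. If `ℓₙ` is the probability of being uninformed after `n` rounds, round `n` loses at least `m
ℓₙ₊₁ - ℓₙ/2` relative to `-1/2`. Telescoping leaves `(m - 1/2) ∑ ℓₙ₊₁ - 1/2`
(`sum_expectedReward_hidingPolicy_le`).

To bound `ℓₙ`, compare with a blind policy that never shows the apex and does not know `u`. Each
round costs a factor of at least `(1 - α)/(1 + 2α)` (`mul_lintegral_blindPolicy_le`). Under the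
blind law the history is independent of `u`, so the average probability of having hit the cap is at
most `n` times the cap's measure (`lintegral_blindPolicy_compl_le`). A cap of angular slope `τ` has
measure `O(τ^(D-1))` (`uniformSphere_cap_le`) and permits `m - 1/2` of order `τ²`. With `τ^(D-1) =
1/N` the gain is of order `N τ² = N^((D-3)/(D-1))`.

For the bound without `-1/2`, the first arm alone yields a constant regret, because it is chosen
before anything is known about `u` (`const_le_bayesRegret`). This covers the range where the main
term is small. -/

theorem lintegral_Ioo_mul_pow (d : ℕ) {τ : ℝ} (hτ : 0 ≤ τ) :
    ∫⁻ h in Ioo (0 : ℝ) 1, ENNReal.ofReal ((τ * h) ^ d)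
      = ENNReal.ofReal (τ ^ d / (d + 1)) := by
  rw [← ofReal_integral_eq_lintegral_ofReal]
  · rw [← integral_Ioc_eq_integral_Ioo, ← intervalIntegral.integral_of_le zero_le_one]
    simp [mul_pow, div_eq_mul_inv]
  · exact ((by fun_prop : Continuous fun h : ℝ => (τ * h) ^ d).integrableOn_Icc
      (a := 0) (b := 1)).mono_set Ioo_subset_Icc_self
  · filter_upwards [ae_restrict_mem measurableSet_Ioo] with h hh
    have := hh.1.le
    positivity

theorem volume_sum_sq_le (d : ℕ) {r : ℝ} (hr : 0 ≤ r) :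
    volume {v : Fin d → ℝ | ∑ i, v i ^ 2 ≤ r ^ 2}
      = ENNReal.ofReal (r ^ d) * volume (ball (0 : EuclideanSpace ℝ (Fin d)) 1) := by
  have h := Measure.addHaar_closedBall (volume : Measure (EuclideanSpace ℝ (Fin d))) 0 hr
  rw [finrank_euclideanSpace_fin] at h
  rw [← h, ← (PiLp.volume_preserving_ofLp (Fin d)).measure_preimage
    (measurableSet_le (by fun_prop) (by fun_prop)).nullMeasurableSet]
  congr 1
  ext v
  simp [EuclideanSpace.norm_eq, Real.sqrt_le_left hr]

/-- The volume of a right circular cone of height one. -/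
theorem volume_cone (d : ℕ) {τ : ℝ} (hτ : 0 ≤ τ) :
    volume {z : EuclideanSpace ℝ (Fin (d + 1)) |
        z 0 ∈ Ioo (0 : ℝ) 1 ∧ ∑ i : Fin d, z i.succ ^ 2 ≤ (τ * z 0) ^ 2}
      = ENNReal.ofReal (τ ^ d / (d + 1)) * volume (ball (0 : EuclideanSpace ℝ (Fin d)) 1) := by
  let S : Set (ℝ × (Fin d → ℝ)) := {p | p.1 ∈ Ioo (0 : ℝ) 1 ∧ ∑ i, p.2 i ^ 2 ≤ (τ * p.1) ^ 2}
  have hS : MeasurableSet S :=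
    (measurable_fst measurableSet_Ioo).inter (measurableSet_le
      (f := fun p : ℝ × (Fin d → ℝ) => ∑ i, p.2 i ^ 2) (g := fun p => (τ * p.1) ^ 2)
      (by fun_prop) (by fun_prop))
  have hmp := (volume_preserving_piFinSuccAbove (fun _ : Fin (d + 1) => ℝ) 0).comp
    (PiLp.volume_preserving_ofLp (Fin (d + 1)))
  have hpre : {z : EuclideanSpace ℝ (Fin (d + 1)) |
        z 0 ∈ Ioo (0 : ℝ) 1 ∧ ∑ i : Fin d, z i.succ ^ 2 ≤ (τ * z 0) ^ 2}
      = (MeasurableEquiv.piFinSuccAbove (fun _ : Fin (d + 1) => ℝ) 0 ∘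
          @WithLp.ofLp 2 (Fin (d + 1) → ℝ)) ⁻¹' S := by
    ext z
    simp [S, MeasurableEquiv.piFinSuccAbove, Fin.tail]
  rw [hpre, hmp.measure_preimage hS.nullMeasurableSet, Measure.volume_eq_prod,
    Measure.prod_apply hS]
  have hslice : ∀ h : ℝ, volume (Prod.mk h ⁻¹' S) = (Ioo (0 : ℝ) 1).indicator
      (fun h => ENNReal.ofReal ((τ * h) ^ d) *
        volume (ball (0 : EuclideanSpace ℝ (Fin d)) 1)) h := by
    intro h
    by_cases hh : h ∈ Ioo (0 : ℝ) 1
    · rw [indicator_of_mem hh, ← volume_sum_sq_le d (mul_nonneg hτ hh.1.le)]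
      congr 1
      ext v
      simp only [S, mem_preimage, mem_ofPred_eq, hh, true_and]
    · rw [indicator_of_notMem hh]
      convert measure_empty (μ := (volume : Measure (Fin d → ℝ)))
      ext v
      simp only [S, mem_preimage, mem_ofPred_eq, hh, false_and, mem_empty_iff_false]
  simp_rw [hslice]
  rw [lintegral_indicator measurableSet_Ioo, lintegral_mul_const _ (by fun_prop),
    lintegral_Ioo_mul_pow d hτ]

/-- The part of the unit ball over a spherical cap with axis `-x` has at most the volume of the
circular cone of height one that contains it. -/
theorem volume_smul_cap_le (d : ℕ) (x : Arm (d + 1)) {τ : ℝ} (hτ : 0 ≤ τ) :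
    volume (Ioo (0 : ℝ) 1 • ((↑) '' {u : Arm (d + 1) |
        inner ℝ (u : EuclideanSpace ℝ (Fin (d + 1))) x < -(1 / √(1 + τ ^ 2))} :
          Set (EuclideanSpace ℝ (Fin (d + 1)))))
      ≤ ENNReal.ofReal (τ ^ d / (d + 1)) * volume (ball (0 : EuclideanSpace ℝ (Fin d)) 1) := by
  have hx : ‖(x : EuclideanSpace ℝ (Fin (d + 1)))‖ = 1 := mem_sphere_zero_iff_norm.1 x.2
  -- Only the value at index `0` is prescribed; it becomes the cone axis in the new orthonormal
  -- coordinates.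
  let v : Fin (d + 1) → EuclideanSpace ℝ (Fin (d + 1)) := fun _ => -x
  have hv : Orthonormal ℝ (({0} : Set (Fin (d + 1))).domRestrict v) := by
    constructor
    · intro i
      change ‖-(x : EuclideanSpace ℝ (Fin (d + 1)))‖ = 1
      rw [norm_neg, hx]
    · intro i j hij
      exact absurd (Subsingleton.elim i j) hij
  obtain ⟨b, hb⟩ := hv.exists_orthonormalBasis_extension_of_card_eq (by simp)
  have hb0 : b 0 = -x := hb 0 rfl
  have hcone : MeasurableSet {z : EuclideanSpace ℝ (Fin (d + 1)) |
      z 0 ∈ Ioo (0 : ℝ) 1 ∧ ∑ i : Fin d, z i.succ ^ 2 ≤ (τ * z 0) ^ 2} :=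
    ((by fun_prop : Measurable fun z : EuclideanSpace ℝ (Fin (d + 1)) => z 0)
      measurableSet_Ioo).inter (measurableSet_le
        (f := fun z : EuclideanSpace ℝ (Fin (d + 1)) => ∑ i : Fin d, z i.succ ^ 2)
        (g := fun z => (τ * z 0) ^ 2) (by fun_prop) (by fun_prop))
  rw [← volume_cone d hτ, ← b.measurePreserving_repr.measure_preimage hcone.nullMeasurableSet]
  refine measure_mono ?_
  rintro _ ⟨t, ⟨ht0, ht1⟩, _, ⟨u, hu, rfl⟩, rfl⟩
  have hun : ‖(u : EuclideanSpace ℝ (Fin (d + 1)))‖ = 1 := mem_sphere_zero_iff_norm.1 u.2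
  set e := inner ℝ (u : EuclideanSpace ℝ (Fin (d + 1))) x with he
  have hs : 0 < √(1 + τ ^ 2) := by positivity
  have hs2 : √(1 + τ ^ 2) ^ 2 = 1 + τ ^ 2 := Real.sq_sqrt (by positivity)
  replace hu : e < -(1 / √(1 + τ ^ 2)) := hu
  have hc0 : b.repr (t • (u : EuclideanSpace ℝ (Fin (d + 1)))) 0 = t * -e := by
    rw [b.repr_apply_apply, hb0, inner_smul_right, inner_neg_left, real_inner_comm]
  have hsum : ∑ i, b.repr (t • (u : EuclideanSpace ℝ (Fin (d + 1)))) i ^ 2 = t ^ 2 := by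
    rw [← EuclideanSpace.real_norm_sq_eq, b.repr.norm_map, norm_smul, hun]
    simp
  rw [Fin.sum_univ_succ, hc0] at hsum
  have hpos : 1 / √(1 + τ ^ 2) < -e := by linarith
  have he0 : 0 < -e := lt_trans (by positivity) hpos
  have he1 : -e ≤ 1 := by
    have := abs_real_inner_le_norm (u : EuclideanSpace ℝ (Fin (d + 1))) x
    rw [hun, hx] at this
    linarith [(abs_le.1 this).1]
  -- This says that the angle to the axis has tangent at most `τ`: `1 - e² ≤ τ² e²`.
  have hsq : 1 ≤ (1 + τ ^ 2) * (-e) ^ 2 := by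
    rw [div_lt_iff₀ hs] at hpos
    nlinarith
  refine ⟨?_, ?_⟩
  · show b.repr (t • (u : EuclideanSpace ℝ (Fin (d + 1)))) 0 ∈ Ioo (0 : ℝ) 1
    rw [hc0]
    exact ⟨by positivity, by nlinarith⟩
  · show ∑ i : Fin d, b.repr (t • (u : EuclideanSpace ℝ (Fin (d + 1)))) i.succ ^ 2
      ≤ (τ * b.repr (t • (u : EuclideanSpace ℝ (Fin (d + 1)))) 0) ^ 2
    rw [hc0]
    nlinarith [mul_le_mul_of_nonneg_left hsq (sq_nonneg t)]

/-- Log-convexity of `Γ` at the midpoint `a` of `a - 1/2` and `a + 1/2`, combined with the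
functional equation. -/
theorem Gamma_sq_mul_le {a : ℝ} (ha : 1 / 2 < a) :
    Real.Gamma a ^ 2 * (a - 1 / 2) ≤ Real.Gamma (a + 1 / 2) ^ 2 := by
  have h := Real.Gamma_mul_add_mul_le_rpow_Gamma_mul_rpow_Gamma
    (s := a - 1 / 2) (t := a + 1 / 2) (a := 1 / 2) (b := 1 / 2)
    (by linarith) (by linarith) (by norm_num) (by norm_num) (by norm_num)
  rw [← Real.sqrt_eq_rpow, ← Real.sqrt_eq_rpow] at h
  have e : 1 / 2 * (a - 1 / 2) + 1 / 2 * (a + 1 / 2) = a := by ring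
  rw [e] at h
  have h1 : 0 < Real.Gamma (a - 1 / 2) := Real.Gamma_pos_of_pos (by linarith)
  have h2 : 0 < Real.Gamma (a + 1 / 2) := Real.Gamma_pos_of_pos (by linarith)
  have h3 : 0 < Real.Gamma a := Real.Gamma_pos_of_pos (by linarith)
  have h4 : Real.Gamma (a + 1 / 2) = (a - 1 / 2) * Real.Gamma (a - 1 / 2) := by
    rw [← Real.Gamma_add_one (by linarith)]
    congr 1
    ring
  have h5 : Real.Gamma a ^ 2 ≤ Real.Gamma (a - 1 / 2) * Real.Gamma (a + 1 / 2) := by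
    calc Real.Gamma a ^ 2 ≤ (√(Real.Gamma (a - 1 / 2)) * √(Real.Gamma (a + 1 / 2))) ^ 2 := by
          gcongr
      _ = _ := by rw [mul_pow, Real.sq_sqrt h1.le, Real.sq_sqrt h2.le]
  calc Real.Gamma a ^ 2 * (a - 1 / 2)
      ≤ Real.Gamma (a - 1 / 2) * Real.Gamma (a + 1 / 2) * (a - 1 / 2) := by
        gcongr
    _ = Real.Gamma (a + 1 / 2) ^ 2 := by
        rw [sq]
        nth_rewrite 2 [h4]
        ring

/-- A sharpening of `Gamma_sq_mul_le`. -/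
theorem Gamma_sq_mul_sq_le {a : ℝ} (ha : 0 < a) :
    Real.Gamma a ^ 2 * a ^ 2 ≤ Real.Gamma (a + 1 / 2) ^ 2 * (a + 1 / 2) := by
  -- Shifting by one and returning by the functional equation replaces the factor `a - 1/2` by the
  -- larger `a² / (a + 1/2)`.
  have h := Gamma_sq_mul_le (a := a + 1) (by linarith)
  have e : a + 1 + 1 / 2 = a + 1 / 2 + 1 := by ring
  rw [e, Real.Gamma_add_one ha.ne', Real.Gamma_add_one (by linarith)] at h
  have e2 : a + 1 - 1 / 2 = a + 1 / 2 := by ring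
  rw [e2] at h
  have : (a + 1 / 2) * (Real.Gamma a ^ 2 * a ^ 2)
      ≤ (a + 1 / 2) * (Real.Gamma (a + 1 / 2) ^ 2 * (a + 1 / 2)) := by nlinarith
  exact le_of_mul_le_mul_left this (by linarith)

/-- The factor in the bound `uniformSphere_cap_le` for the measure of a spherical cap. -/
noncomputable def capConst (D : ℕ) : ℝ := √(((D : ℝ) + 1) / (2 * Real.pi * (D : ℝ) ^ 2))

theorem capConst_nonneg (D : ℕ) : 0 ≤ capConst D := Real.sqrt_nonneg _

/-- The volume ratio is a quotient of Gamma values half a unit apart, which `Gamma_sq_mul_sq_le`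
controls; `capConst` is the resulting constant. -/
theorem volume_ball_le_succ {d : ℕ} (hd : 0 < d) :
    volume (ball (0 : EuclideanSpace ℝ (Fin d)) 1)
      ≤ ENNReal.ofReal ((d + 1) * capConst (d + 1)) *
        volume (ball (0 : EuclideanSpace ℝ (Fin (d + 1))) 1) := by
  have : Nonempty (Fin d) := ⟨⟨0, hd⟩⟩
  rw [EuclideanSpace.volume_ball, EuclideanSpace.volume_ball]
  simp only [ENNReal.ofReal_one, one_pow, one_mul, Fintype.card_fin]
  rw [← ENNReal.ofReal_mul (by have := capConst_nonneg (d + 1); positivity)]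
  apply ENNReal.ofReal_le_ofReal
  set a : ℝ := ((d : ℝ) + 1) / 2 with ha
  have ha0 : 0 < a := by positivity
  have e1 : (d : ℝ) / 2 + 1 = a + 1 / 2 := by rw [ha]; ring
  have e2 : ((d + 1 : ℕ) : ℝ) / 2 + 1 = a + 1 := by rw [ha]; push_cast; ring
  rw [e1, e2, Real.Gamma_add_one ha0.ne']
  have hG1 := Real.Gamma_pos_of_pos ha0
  have hG2 := Real.Gamma_pos_of_pos (show 0 < a + 1 / 2 by linarith)
  have key : Real.Gamma a * a ≤ Real.Gamma (a + 1 / 2) * √(a + 1 / 2) := by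
    refine le_of_sq_le_sq ?_ (by positivity)
    rw [mul_pow, mul_pow, Real.sq_sqrt (by linarith)]
    exact Gamma_sq_mul_sq_le ha0
  have hc : capConst (d + 1) * (d + 1) * √Real.pi = √(a + 1 / 2) := by
    rw [capConst, ← Real.sqrt_sq (show (0 : ℝ) ≤ d + 1 by positivity),
      ← Real.sqrt_mul (by positivity), ← Real.sqrt_mul (by positivity), ha]
    congr 1
    push_cast
    field_simp
  rw [div_le_iff₀ hG2, pow_succ]
  have : (↑d + 1) * capConst (d + 1) * (√Real.pi ^ d * √Real.pi / (a * Real.Gamma a)) *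
      Real.Gamma (a + 1 / 2) = √Real.pi ^ d * ((Real.Gamma (a + 1 / 2) * √(a + 1 / 2)) /
        (Real.Gamma a * a)) := by
    rw [← hc]
    ring
  rw [this]
  refine le_mul_of_one_le_right (by positivity) ?_
  rwa [one_le_div (by positivity)]

instance (D : ℕ) [NeZero D] : IsProbabilityMeasure (uniformSphere D) := by
  constructor
  rw [uniformSphere, Measure.smul_apply, smul_eq_mul]
  refine ENNReal.inv_mul_cancel ?_ (measure_ne_top _ _)
  have : Nontrivial (EuclideanSpace ℝ (Fin D)) := by
    have : Nonempty (Fin D) := ⟨0⟩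
    infer_instance
  exact fun h => Measure.toSphere_ne_zero _ (Measure.measure_univ_eq_zero.1 h)

/-- Surface measure is proportional to the volume of the solid sector over the cap, and that sector
lies in a circular cone of height one and base radius `τ`. -/
theorem uniformSphere_cap_le {D : ℕ} (hD : 2 ≤ D) (x : Arm D) {τ : ℝ} (hτ : 0 ≤ τ) :
    uniformSphere D {u : Arm D | inner ℝ (u : EuclideanSpace ℝ (Fin D)) x < -(1 / √(1 + τ ^ 2))}
      ≤ ENNReal.ofReal (capConst D * τ ^ (D - 1)) := by
  obtain ⟨d, rfl⟩ : ∃ d, D = d + 1 := ⟨D - 1, by omega⟩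
  have hm : MeasurableSet {u : Arm (d + 1) |
      inner ℝ (u : EuclideanSpace ℝ (Fin (d + 1))) x < -(1 / √(1 + τ ^ 2))} :=
    measurableSet_lt (by fun_prop) (by fun_prop)
  rw [uniformSphere, Measure.smul_apply, smul_eq_mul, Measure.toSphere_apply' _ hm,
    Measure.toSphere_apply_univ, finrank_euclideanSpace_fin]
  have hV : volume (ball (0 : EuclideanSpace ℝ (Fin (d + 1))) 1) ≠ 0 :=
    (measure_ball_pos _ _ one_pos).ne'
  have hV' : volume (ball (0 : EuclideanSpace ℝ (Fin (d + 1))) 1) ≠ ∞ := measure_ball_lt_top.ne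
  have hn : ((d + 1 : ℕ) : ℝ≥0∞) ≠ 0 := by simp
  rw [ENNReal.inv_mul_le_iff (mul_ne_zero hn hV)
    (ENNReal.mul_ne_top (ENNReal.natCast_ne_top _) hV'), mul_assoc]
  gcongr
  refine (volume_smul_cap_le d x hτ).trans ?_
  refine (mul_le_mul_right (volume_ball_le_succ (by omega)) _).trans_eq ?_
  rw [← mul_assoc, ← ENNReal.ofReal_mul (by positivity), mul_comm]
  congr 2
  rw [Nat.add_sub_cancel]
  field_simp

end ConeBandit

/-! ### Three-point outcome distributions -/

namespace ConeBandit

open ImpreciseBandit Set Metric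

noncomputable section

variable {D : ℕ}

theorem norm_arm (x : Arm D) : ‖(x : EuclideanSpace ℝ (Fin D))‖ = 1 :=
  mem_sphere_zero_iff_norm.1 x.2

theorem sum_sq_arm (x : Arm D) : ∑ i, (x : EuclideanSpace ℝ (Fin D)) i ^ 2 = 1 := by
  rw [← EuclideanSpace.real_norm_sq_eq, norm_arm, one_pow]

theorem abs_inner_arm_le (u x : Arm D) :
    |inner ℝ (u : EuclideanSpace ℝ (Fin D)) x| ≤ 1 := by
  simpa [norm_arm] using abs_real_inner_le_norm (u : EuclideanSpace ℝ (Fin D)) x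

/-- The apex `(1, 0, 0)` of the cone of outcomes. -/
def apex (D : ℕ) : outcomeSet D :=
  ⟨WithLp.toLp 2 (Matrix.vecCons 1 (Matrix.vecCons 0 fun _ => 0)), by simp [outcomeSet]⟩

/-- The boundary point `(0, 1, x)` of the base of the cone of outcomes. -/
def rim (x : Arm D) : outcomeSet D :=
  ⟨WithLp.toLp 2 (Matrix.vecCons 0 (Matrix.vecCons 1 fun i => (x : EuclideanSpace ℝ (Fin D)) i)),
    by simp [outcomeSet, sum_sq_arm]⟩

@[simp] theorem apex_zero : (apex D : Y D) 0 = 1 := rfl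
@[simp] theorem apex_one : (apex D : Y D) 1 = 0 := rfl
@[simp] theorem apex_succ_succ (i : Fin D) : (apex D : Y D) i.succ.succ = 0 := rfl
@[simp] theorem rim_zero (x : Arm D) : (rim x : Y D) 0 = 0 := rfl
@[simp] theorem rim_one (x : Arm D) : (rim x : Y D) 1 = 1 := rfl
@[simp] theorem rim_succ_succ (x : Arm D) (i : Fin D) :
    (rim x : Y D) i.succ.succ = (x : EuclideanSpace ℝ (Fin D)) i := rfl

theorem measurable_rim : Measurable (rim : Arm D → outcomeSet D) := by
  refine Measurable.subtype_mk ((WithLp.measurable_toLp _ _).comp (measurable_pi_lambda _ ?_))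
  intro i
  refine Fin.cases ?_ (fun i => Fin.cases ?_ (fun i => ?_) i) i
  · exact measurable_const
  · exact measurable_const
  · exact (by fun_prop : Measurable fun x : Arm D => (x : EuclideanSpace ℝ (Fin D)) i)

theorem measurable_neg_arm : Measurable (fun x : Arm D => -x) :=
  (measurable_subtype_coe.neg).subtype_mk

@[simp] theorem reward_apex (x : Arm D) : reward D x (apex D) = 0 := by simp [reward]

@[simp] theorem reward_rim (x : Arm D) : reward D x (rim x) = 1 := by
  simp [reward, ← sq, sum_sq_arm]

@[simp] theorem reward_rim_neg (x : Arm D) : reward D x (rim (-x)) = -1 := by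
  simp [reward, ← sq, sum_sq_arm]

theorem measurable_reward :
    Measurable fun p : Arm D × outcomeSet D => reward D p.1 p.2 := by
  unfold reward
  fun_prop

theorem abs_reward_le (x : Arm D) (y : outcomeSet D) : |reward D x y| ≤ 1 := by
  obtain ⟨h1, h2, h3, h4⟩ := y.2
  have hy : ∑ i : Fin D, (y : Y D) i.succ.succ ^ 2 ≤ 1 := h4.trans (by nlinarith)
  have hcs := Finset.sum_mul_sq_le_sq_mul_sq Finset.univ
    (fun i => (x : EuclideanSpace ℝ (Fin D)) i) (fun i : Fin D => (y : Y D) i.succ.succ)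
  rw [sum_sq_arm, one_mul] at hcs
  exact abs_le_of_sq_le_sq (by rw [one_pow]; exact hcs.trans hy) zero_le_one

/-- The outcome is the apex with probability `p`; otherwise it is `(0, 1, -x)` or `(0, 1, x)`,
and the mean of the last component is `-m x`. -/
def threePoint (p m : ℝ) (x : Arm D) : Measure (outcomeSet D) :=
  ENNReal.ofReal p • Measure.dirac (apex D)
    + ENNReal.ofReal ((1 - p) * ((1 + m) / 2)) • Measure.dirac (rim (-x))
    + ENNReal.ofReal ((1 - p) * ((1 - m) / 2)) • Measure.dirac (rim x)

theorem isProbabilityMeasure_threePoint {p m : ℝ} (hp : p ∈ Icc (0 : ℝ) 1) (hm : m ∈ Icc (0 : ℝ) 1)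
    (x : Arm D) : IsProbabilityMeasure (threePoint p m x) := by
  obtain ⟨hp0, hp1⟩ := hp
  obtain ⟨hm0, hm1⟩ := hm
  have h1 : 0 ≤ (1 - p) * ((1 + m) / 2) := by apply mul_nonneg <;> linarith
  have h2 : 0 ≤ (1 - p) * ((1 - m) / 2) := by apply mul_nonneg <;> linarith
  constructor
  simp only [threePoint, Measure.add_apply, Measure.smul_apply, measure_univ, smul_eq_mul, mul_one]
  rw [← ENNReal.ofReal_add hp0 h1, ← ENNReal.ofReal_add (by positivity) h2,
    ← ENNReal.ofReal_one]
  congr 1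
  ring

theorem integral_threePoint {E : Type*} [NormedAddCommGroup E] [NormedSpace ℝ E] [CompleteSpace E]
    {p m : ℝ} (hp : p ∈ Icc (0 : ℝ) 1) (hm : m ∈ Icc (0 : ℝ) 1) (x : Arm D)
    (f : outcomeSet D → E) :
    ∫ y, f y ∂(threePoint p m x) = p • f (apex D) + ((1 - p) * ((1 + m) / 2)) • f (rim (-x))
      + ((1 - p) * ((1 - m) / 2)) • f (rim x) := by
  obtain ⟨hp0, hp1⟩ := hp
  obtain ⟨hm0, hm1⟩ := hm
  have h1 : 0 ≤ (1 - p) * ((1 + m) / 2) := by apply mul_nonneg <;> linarith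
  have h2 : 0 ≤ (1 - p) * ((1 - m) / 2) := by apply mul_nonneg <;> linarith
  have hd : ∀ (c : ℝ) (y : outcomeSet D),
      Integrable f (ENNReal.ofReal c • Measure.dirac y) := fun c y =>
    (integrable_dirac (by simp)).smul_measure ENNReal.ofReal_ne_top
  rw [threePoint, integral_add_measure ((hd _ _).add_measure (hd _ _)) (hd _ _),
    integral_add_measure (hd _ _) (hd _ _)]
  simp only [integral_smul_measure, integral_dirac, ENNReal.toReal_ofReal, hp0, h1, h2]

theorem lintegral_threePoint (p m : ℝ) (x : Arm D) (f : outcomeSet D → ℝ≥0∞) :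
    ∫⁻ y, f y ∂(threePoint p m x) = ENNReal.ofReal p * f (apex D)
      + ENNReal.ofReal ((1 - p) * ((1 + m) / 2)) * f (rim (-x))
      + ENNReal.ofReal ((1 - p) * ((1 - m) / 2)) * f (rim x) := by
  simp [threePoint, lintegral_add_measure]

theorem measurable_threePoint {β : Type*} [MeasurableSpace β] {p m : β → ℝ} {x : β → Arm D}
    (hp : Measurable p) (hm : Measurable m) (hx : Measurable x) :
    Measurable fun b => threePoint (p b) (m b) (x b) := by
  refine Measure.measurable_of_measurable_coe _ fun s hs => ?_
  have hd : ∀ {f : β → outcomeSet D}, Measurable f →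
      Measurable fun b => Measure.dirac (f b) s := fun hf =>
    (Measure.measurable_coe hs).comp (Measure.measurable_dirac.comp hf)
  simp only [threePoint, Measure.add_apply, Measure.smul_apply, smul_eq_mul]
  have h1 := hd (measurable_rim.comp hx)
  have h2 := hd (measurable_rim.comp (measurable_neg_arm.comp hx))
  have h3 := hd (measurable_const (a := apex D))
  simp only [Function.comp_def] at h1 h2
  fun_prop

theorem inner_paramVec (α : ℝ) (u : EuclideanSpace ℝ (Fin D)) (y : Y D) :
    inner ℝ (paramVec α u) y
      = (1 - α) * y 0 - α * y 1 + 2 * α * ∑ i : Fin D, u i * y i.succ.succ := by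
  rw [PiLp.inner_apply, Fin.sum_univ_succ, Fin.sum_univ_succ, Finset.mul_sum]
  simp only [paramVec, RCLike.inner_apply, conj_trivial]
  have h1 : (Fin.succ 0 : Fin (D + 2)) = 1 := rfl
  simp only [h1, Matrix.cons_val_zero, Matrix.cons_val_one, Matrix.cons_val_succ]
  rw [← add_assoc]
  congr 1
  · ring
  · exact Finset.sum_congr rfl fun i _ => by ring

/-- The probability of the apex that makes the three-point distribution at `x` with mean
parameter `m` compatible with the hypothesis `(1 - α, -α, 2αu)`. -/
def apexProb (α : ℝ) (u : Arm D) (m : ℝ) (x : Arm D) : ℝ :=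
  α * (1 + 2 * m * inner ℝ (u : EuclideanSpace ℝ (Fin D)) x) /
    (1 + 2 * α * m * inner ℝ (u : EuclideanSpace ℝ (Fin D)) x)

theorem apexProb_denom_pos {α : ℝ} (hα : α ∈ Ioc (0 : ℝ) (1 / 4)) (u : Arm D) {m : ℝ}
    (hm : m ∈ Icc (0 : ℝ) 1) (x : Arm D) :
    0 < 1 + 2 * α * m * inner ℝ (u : EuclideanSpace ℝ (Fin D)) x := by
  have h := abs_le.1 (abs_inner_arm_le u x)
  have hm' : -1 ≤ m * inner ℝ (u : EuclideanSpace ℝ (Fin D)) x := by nlinarith [hm.1, hm.2]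
  nlinarith [hα.1, hα.2]

theorem one_sub_apexProb {α : ℝ} (hα : α ∈ Ioc (0 : ℝ) (1 / 4)) (u : Arm D) {m : ℝ}
    (hm : m ∈ Icc (0 : ℝ) 1) (x : Arm D) :
    1 - apexProb α u m x
      = (1 - α) / (1 + 2 * α * m * inner ℝ (u : EuclideanSpace ℝ (Fin D)) x) := by
  have h := apexProb_denom_pos hα u hm x
  rw [apexProb, eq_div_iff h.ne', sub_mul, div_mul_cancel₀ _ h.ne']
  ring

theorem le_one_sub_apexProb {α : ℝ} (hα : α ∈ Ioc (0 : ℝ) (1 / 4)) (u : Arm D) {m : ℝ}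
    (hm : m ∈ Icc (0 : ℝ) 1) (x : Arm D) :
    (1 - α) / (1 + 2 * α) ≤ 1 - apexProb α u m x := by
  have h := apexProb_denom_pos hα u hm x
  rw [one_sub_apexProb hα u hm x]
  have h' := abs_le.1 (abs_inner_arm_le u x)
  have hm' : m * inner ℝ (u : EuclideanSpace ℝ (Fin D)) x ≤ 1 := by nlinarith [hm.1, hm.2]
  have := hα.2
  refine div_le_div_of_nonneg_left (by linarith) h ?_
  nlinarith [hα.1]

theorem apexProb_mem {α : ℝ} (hα : α ∈ Ioc (0 : ℝ) (1 / 4)) (u : Arm D) {m : ℝ}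
    (hm : m ∈ Icc (0 : ℝ) 1) (x : Arm D)
    (h : 0 ≤ 1 + 2 * m * inner ℝ (u : EuclideanSpace ℝ (Fin D)) x) :
    apexProb α u m x ∈ Icc (0 : ℝ) 1 := by
  refine ⟨div_nonneg (mul_nonneg hα.1.le h) (apexProb_denom_pos hα u hm x).le, ?_⟩
  have h1 := le_one_sub_apexProb hα u hm x
  have : 0 ≤ (1 - α) / (1 + 2 * α) := div_nonneg (by linarith [hα.2]) (by linarith [hα.1])
  linarith

/-- The mean is `(p, 1 - p, -(1 - p) m x)`. It lies in the cone because `m ≤ 1`, and `apexProb` is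
the solution `p` of the linear constraint. -/
theorem threePoint_mem_hypothesis {α : ℝ} (hα : α ∈ Ioc (0 : ℝ) (1 / 4)) (u : Arm D) {m : ℝ}
    (hm : m ∈ Icc (0 : ℝ) 1) (x : Arm D)
    (h : 0 ≤ 1 + 2 * m * inner ℝ (u : EuclideanSpace ℝ (Fin D)) x) :
    threePoint (apexProb α u m x) m x ∈ hypothesis D (paramVec α u) x := by
  have hp := apexProb_mem hα u hm x h
  refine ⟨isProbabilityMeasure_threePoint hp hm x, ?_⟩
  have hden := apexProb_denom_pos hα u hm x
  have h1p := one_sub_apexProb hα u hm x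
  rw [integral_threePoint hp hm x]
  set p := apexProb α u m x with hpdef
  set y : Y D := p • (apex D : Y D) + ((1 - p) * ((1 + m) / 2)) • (rim (-x) : Y D)
    + ((1 - p) * ((1 - m) / 2)) • (rim x : Y D) with hy
  have y0 : y 0 = p := by simp [hy]
  have y1 : y 1 = 1 - p := by simp [hy]; ring
  have yi : ∀ i : Fin D, y i.succ.succ = -((1 - p) * m) * (x : EuclideanSpace ℝ (Fin D)) i := by
    intro i
    simp [hy]
    ring
  refine ⟨?_, ?_, ?_, ?_, ?_⟩
  · change innerₛₗ ℝ (paramVec α u) y = 0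
    rw [innerₛₗ_apply_apply, inner_paramVec, y0, y1]
    have : ∑ i : Fin D, (u : EuclideanSpace ℝ (Fin D)) i * y i.succ.succ
        = -((1 - p) * m) * inner ℝ (u : EuclideanSpace ℝ (Fin D)) x := by
      rw [PiLp.inner_apply, Finset.mul_sum]
      refine Finset.sum_congr rfl fun i _ => ?_
      simp only [yi, RCLike.inner_apply, conj_trivial]
      ring
    rw [this]
    set c := inner ℝ (u : EuclideanSpace ℝ (Fin D)) x
    rw [eq_div_iff hden.ne'] at h1p
    linear_combination -h1p
  · rw [y0, y1]; ring
  · rw [y0]; exact hp.1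
  · rw [y1]; linarith [hp.2]
  · simp only [yi, mul_pow]
    rw [← Finset.mul_sum, sum_sq_arm, y1]
    have := sq_nonneg (1 - p)
    have hm2 : m ^ 2 ≤ 1 := pow_le_one₀ hm.1 hm.2
    nlinarith

theorem integral_reward_threePoint {p m : ℝ} (hp : p ∈ Icc (0 : ℝ) 1) (hm : m ∈ Icc (0 : ℝ) 1)
    (x : Arm D) : ∫ y, reward D x y ∂(threePoint p m x) = -((1 - p) * m) := by
  rw [integral_threePoint hp hm x]
  simp
  ring

/-- The nature policy that answers the arm `x` by the three-point distribution with mean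
parameter `m n (h, x)`. -/
def threePointPolicy {α : ℝ} (hα : α ∈ Ioc (0 : ℝ) (1 / 4)) (u : Arm D)
    (m : ∀ n, History (Arm D) (outcomeSet D) n × Arm D → ℝ) (hmeas : ∀ n, Measurable (m n))
    (hm : ∀ n q, m n q ∈ Icc (0 : ℝ) 1)
    (hc : ∀ n q, 0 ≤ 1 + 2 * m n q * inner ℝ (u : EuclideanSpace ℝ (Fin D)) q.2) :
    NaturePolicy (hypothesis D (paramVec α u)) where
  kernel n := ⟨fun q => threePoint (apexProb α u (m n q) q.2) (m n q) q.2, by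
    have := hmeas n
    refine measurable_threePoint ?_ this measurable_snd
    unfold apexProb
    fun_prop⟩
  isMarkovKernel n :=
    ⟨fun q => isProbabilityMeasure_threePoint (apexProb_mem hα u (hm n q) q.2 (hc n q)) (hm n q) _⟩
  compatible n h x := threePoint_mem_hypothesis hα u (hm n (h, x)) x (hc n (h, x))

/-- The mean parameter for which the three-point distribution at `x` guarantees an expected reward
of at most `-1/2`, where `c` is the inner product of `x` and the hypothesis direction. -/
def safeMean (c : ℝ) : ℝ := if -(1 / 2) ≤ c then 1 else -1 / (2 * c)

theorem measurable_safeMean : Measurable safeMean :=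
  Measurable.ite measurableSet_Ici measurable_const (by fun_prop)

theorem safeMean_mem_Icc (c : ℝ) : safeMean c ∈ Icc (0 : ℝ) 1 := by
  unfold safeMean
  split_ifs with h
  · norm_num
  · push Not at h
    refine ⟨div_nonneg_of_nonpos (by norm_num) (by linarith), ?_⟩
    rw [div_le_one_of_neg (by linarith)]
    linarith

theorem safeMean_mul_nonneg (c : ℝ) : 0 ≤ 1 + 2 * safeMean c * c := by
  unfold safeMean
  split_ifs with h
  · linarith
  · push Not at h
    have : c ≠ 0 := by linarith
    field_simp
    norm_num

/-- The expected reward of the safe three-point distribution, with the sign changed. -/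
theorem half_le_safeMean {α : ℝ} (hα : α ∈ Ioc (0 : ℝ) (1 / 4)) (u x : Arm D) :
    1 / 2 ≤ (1 - apexProb α u (safeMean (inner ℝ (u : EuclideanSpace ℝ (Fin D)) x)) x)
      * safeMean (inner ℝ (u : EuclideanSpace ℝ (Fin D)) x) := by
  have hc := abs_le.1 (abs_inner_arm_le u x)
  rw [one_sub_apexProb hα u (safeMean_mem_Icc _) x]
  have hd := apexProb_denom_pos hα u
    (safeMean_mem_Icc (inner ℝ (u : EuclideanSpace ℝ (Fin D)) x)) x
  revert hd
  generalize inner ℝ (u : EuclideanSpace ℝ (Fin D)) x = c at *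
  unfold safeMean
  obtain ⟨h0, h1⟩ := hα
  split_ifs with h
  -- Here `α ≤ 1/4` is sharp: the worst case is `(1 - α)/(1 + 2α) ≥ 1/2`.
  · intro hd
    rw [mul_one, div_le_div_iff₀ two_pos hd]
    nlinarith
  · intro hd
    push Not at h
    have hc0 : c ≠ 0 := by linarith
    -- In this branch the apex has probability zero, so the reward is `1/(2c)`, at most `-1/2`
    -- because `c ≥ -1`.
    have e : 1 + 2 * α * (-1 / (2 * c)) * c = 1 - α := by field_simp; ring
    rw [e, div_self (by linarith), one_mul, neg_div, le_neg, ← neg_div,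
      div_le_iff_of_neg (by linarith)]
    linarith

/-- Away from the poles, the safe three-point distribution is worse than necessary. -/
theorem half_add_le_safeMean {α : ℝ} (hα : α ∈ Ioc (0 : ℝ) (1 / 4)) (u x : Arm D)
    (h : |inner ℝ (u : EuclideanSpace ℝ (Fin D)) x| ≤ 1 / √2) :
    1 / 2 + 1 / 20 ≤ (1 - apexProb α u (safeMean (inner ℝ (u : EuclideanSpace ℝ (Fin D)) x)) x)
      * safeMean (inner ℝ (u : EuclideanSpace ℝ (Fin D)) x) := by
  have hs : 1 / √2 ≤ (71 / 100 : ℝ) := by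
    rw [div_le_iff₀ (by positivity)]
    have : (1.41 : ℝ) ≤ √2 := Real.le_sqrt_of_sq_le (by norm_num)
    linarith
  have hc := abs_le.1 (h.trans hs)
  rw [one_sub_apexProb hα u (safeMean_mem_Icc _) x]
  have hd := apexProb_denom_pos hα u
    (safeMean_mem_Icc (inner ℝ (u : EuclideanSpace ℝ (Fin D)) x)) x
  revert hd
  generalize inner ℝ (u : EuclideanSpace ℝ (Fin D)) x = c at *
  unfold safeMean
  obtain ⟨h0, h1⟩ := hα
  split_ifs with h
  · intro hd
    rw [mul_one, le_div_iff₀ hd]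
    nlinarith
  · intro hd
    push Not at h
    have hc0 : c ≠ 0 := by linarith
    have e : 1 + 2 * α * (-1 / (2 * c)) * c = 1 - α := by field_simp; ring
    rw [e, div_self (by linarith), one_mul, neg_div, le_neg,
      div_le_iff_of_neg (by linarith)]
    linarith

/-! ### The value of the best arm -/

theorem integrable_outcome (ζ : Measure (outcomeSet D)) [IsProbabilityMeasure ζ] :
    Integrable (fun y : outcomeSet D => (y : Y D)) ζ := by
  refine Integrable.of_bound measurable_subtype_coe.aestronglyMeasurable 2 (ae_of_all _ fun y => ?_)
  obtain ⟨h1, h2, h3, h4⟩ := y.2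
  refine le_of_sq_le_sq ?_ zero_le_two
  rw [EuclideanSpace.real_norm_sq_eq, Fin.sum_univ_succ, Fin.sum_univ_succ]
  have e : (Fin.succ 0 : Fin (D + 2)) = 1 := rfl
  rw [e]
  nlinarith

theorem integral_reward_eq (ζ : Measure (outcomeSet D)) [IsProbabilityMeasure ζ] (x : Arm D) :
    ∫ y, reward D x y ∂ζ = ∑ i : Fin D, (x : EuclideanSpace ℝ (Fin D)) i *
      (∫ y, (y : Y D) ∂ζ) i.succ.succ := by
  have hcoord : ∀ j : Fin (D + 2), (∫ y, (y : Y D) ∂ζ) j = ∫ y : outcomeSet D, (y : Y D) j ∂ζ :=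
    fun j => ((EuclideanSpace.proj (𝕜 := ℝ) j).integral_comp_comm (integrable_outcome ζ)).symm
  have hint : ∀ j : Fin (D + 2), Integrable (fun y : outcomeSet D => (y : Y D) j) ζ :=
    fun j => (EuclideanSpace.proj (𝕜 := ℝ) j).integrable_comp (integrable_outcome ζ)
  unfold reward
  rw [integral_finsetSum _ fun i _ => (hint i.succ.succ).const_mul _]
  simp only [integral_const_mul, hcoord]

/-- The arm `-u` attests the bound: `y₀ = α(1 - 2⟨u, v⟩)` and `y₀ ≥ 0` give `⟨u, v⟩ ≤ 1/2` for every
admissible mean. -/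
theorem neg_half_le_iSup_lowerPrevision {α : ℝ} (hα : α ∈ Ioc (0 : ℝ) (1 / 4)) (u : Arm D) :
    -(1 / 2) ≤ ⨆ x, lowerPrevision (hypothesis D (paramVec α u)) (reward D) x := by
  have hbound : ∀ x, ∀ ζ ∈ hypothesis D (paramVec α u) x, |∫ y, reward D x y ∂ζ| ≤ 1 := by
    intro x ζ hζ
    have := hζ.1
    simpa using norm_integral_le_of_norm_le_const (μ := ζ) (f := reward D x) (C := 1)
      (ae_of_all _ fun y => abs_reward_le x y)
  -- Real suprema of unbounded sets and infima of empty sets default to `0`; boundedness is proved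
  -- here, and the safe distribution shows that each credal set is nonempty.
  have hbdd : BddAbove (range fun x =>
      lowerPrevision (hypothesis D (paramVec α u)) (reward D) x) := by
    refine ⟨1, ?_⟩
    rintro _ ⟨x, rfl⟩
    have hmem := threePoint_mem_hypothesis hα u (safeMean_mem_Icc _) x
      (safeMean_mul_nonneg (inner ℝ (u : EuclideanSpace ℝ (Fin D)) x))
    refine (csInf_le (s := (fun ζ => ∫ y, reward D x y ∂ζ) '' hypothesis D (paramVec α u) x)
      ⟨-1, ?_⟩ ⟨_, hmem, rfl⟩).trans (abs_le.1 (hbound _ _ hmem)).2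
    rintro _ ⟨ζ, hζ, rfl⟩
    exact (abs_le.1 (hbound _ _ hζ)).1
  refine le_trans ?_ (le_ciSup hbdd (-u))
  have hmem := threePoint_mem_hypothesis hα u (safeMean_mem_Icc _) (-u)
      (safeMean_mul_nonneg (inner ℝ (u : EuclideanSpace ℝ (Fin D)) (-u : Arm D)))
  refine le_csInf ⟨_, _, hmem, rfl⟩ ?_
  rintro _ ⟨ζ, hζ, rfl⟩
  obtain ⟨hprob, hker, h1, h2, -, -⟩ := hζ
  change innerₛₗ ℝ (paramVec α u) (∫ y, (y : Y D) ∂ζ) = 0 at hker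
  rw [innerₛₗ_apply_apply, inner_paramVec] at hker
  change -(1 / 2) ≤ ∫ y, reward D (-u) y ∂ζ
  rw [integral_reward_eq]
  simp only [coe_neg_sphere, PiLp.neg_apply, neg_mul, Finset.sum_neg_distrib]
  have := hα.1
  nlinarith

end

end ConeBandit

/-! ### Recursion for the law of the history -/

namespace ImpreciseBandit

variable {A O : Type*} [MeasurableSpace A] [MeasurableSpace O] {H : A → Set (Measure O)}

instance (ν : NaturePolicy H) (n : ℕ) : IsMarkovKernel (ν.kernel n) := ν.isMarkovKernel n

instance (φ : AgentPolicy A O) (ν : NaturePolicy H) (n : ℕ) :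
    IsMarkovKernel (roundKernel φ ν n) := by
  unfold roundKernel
  infer_instance

theorem measurable_snoc (n : ℕ) : Measurable fun p : History A O n × (A × O) =>
    (Fin.snoc p.1 p.2 : History A O (n + 1)) := by
  refine measurable_pi_lambda _ fun i => ?_
  refine Fin.lastCases ?_ (fun i => ?_) i
  · simpa using measurable_snd
  · simp only [Fin.snoc_castSucc]
    fun_prop

instance isProbabilityMeasure_historyLaw (φ : AgentPolicy A O) (ν : NaturePolicy H) (n : ℕ) :
    IsProbabilityMeasure (historyLaw φ ν n) := by
  induction n with
  | zero => exact Measure.dirac.isProbabilityMeasure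
  | succ n ih => exact Measure.isProbabilityMeasure_map (measurable_snoc n).aemeasurable

theorem lintegral_historyLaw_succ (φ : AgentPolicy A O) (ν : NaturePolicy H) (n : ℕ)
    {f : History A O (n + 1) → ℝ≥0∞} (hf : Measurable f) :
    ∫⁻ h, f h ∂(historyLaw φ ν (n + 1))
      = ∫⁻ h, ∫⁻ y, f (Fin.snoc h (φ.act n h, y)) ∂(ν.kernel n (h, φ.act n h))
          ∂(historyLaw φ ν n) := by
  have hf' : Measurable fun p : History A O n × (A × O) => f (Fin.snoc p.1 p.2) :=
    hf.comp (measurable_snoc n)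
  rw [historyLaw, lintegral_map hf (measurable_snoc n), Measure.lintegral_compProd hf']
  refine lintegral_congr fun h => ?_
  have hfh : Measurable fun q : A × O => f (Fin.snoc h q) := hf'.comp measurable_prodMk_left
  rw [roundKernel, Kernel.lintegral_compProd _ _ _ hfh, Kernel.lintegral_deterministic']
  have hg : Measurable fun p : (History A O n × A) × O => f (Fin.snoc h (p.1.2, p.2)) :=
    hfh.comp (by fun_prop : Measurable fun p : (History A O n × A) × O => (p.1.2, p.2))
  exact (hg.lintegral_kernel_prod_right' (κ := ν.kernel n)).comp
    (measurable_prodMk_left (x := h))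

theorem integral_historyLaw_succ [MeasurableSingletonClass A] (φ : AgentPolicy A O)
    (ν : NaturePolicy H) (n : ℕ) {f : History A O (n + 1) → ℝ} (hf : Measurable f) {C : ℝ}
    (hC : ∀ h, |f h| ≤ C) :
    ∫ h, f h ∂(historyLaw φ ν (n + 1))
      = ∫ h, ∫ y, f (Fin.snoc h (φ.act n h, y)) ∂(ν.kernel n (h, φ.act n h))
          ∂(historyLaw φ ν n) := by
  have hf' : Measurable fun p : History A O n × (A × O) => f (Fin.snoc p.1 p.2) :=
    hf.comp (measurable_snoc n)
  rw [historyLaw, integral_map (measurable_snoc n).aemeasurable hf.aestronglyMeasurable,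
    Measure.integral_compProd (Integrable.of_bound hf'.aestronglyMeasurable C
      (ae_of_all _ fun _ => hC _))]
  refine integral_congr_ae (ae_of_all _ fun h => ?_)
  have hfh : Measurable fun q : A × O => f (Fin.snoc h q) := hf'.comp measurable_prodMk_left
  simp only
  rw [roundKernel, integral_compProd (Integrable.of_bound hfh.aestronglyMeasurable C
      (ae_of_all _ fun _ => hC _)), Kernel.integral_deterministic]

end ImpreciseBandit

/-! ### A nature policy that hides the hypothesis -/

namespace ConeBandit

open ImpreciseBandit Set Metric

noncomputable section

variable {D : ℕ}

/-- The histories in which no outcome was the apex and no arm was close to `-u`: all arms `x` admit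
the three-point distribution with mean parameter `m`. -/
def uninformed (m : ℝ) (u : Arm D) (n : ℕ) : Set (History (Arm D) (outcomeSet D) n) :=
  {h | ∀ k, ((h k).2 : Y D) 0 = 0 ∧
    0 ≤ 1 + 2 * m * inner ℝ (u : EuclideanSpace ℝ (Fin D)) (h k).1}

theorem snoc_mem_uninformed {m : ℝ} {u : Arm D} {n : ℕ}
    {h : History (Arm D) (outcomeSet D) n} {x : Arm D} {y : outcomeSet D} :
    (Fin.snoc h (x, y) : History (Arm D) (outcomeSet D) (n + 1)) ∈ uninformed m u (n + 1) ↔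
      h ∈ uninformed m u n ∧ (y : Y D) 0 = 0 ∧
        0 ≤ 1 + 2 * m * inner ℝ (u : EuclideanSpace ℝ (Fin D)) x := by
  simp only [uninformed, mem_ofPred_eq, Fin.forall_fin_succ', Fin.snoc_castSucc, Fin.snoc_last]

theorem measurableSet_uninformed_prod (m : ℝ) (n : ℕ) :
    MeasurableSet {q : Arm D × History (Arm D) (outcomeSet D) n | q.2 ∈ uninformed m q.1 n} := by
  simp only [uninformed, mem_ofPred_eq]
  rw [ofPred_forall]
  refine MeasurableSet.iInter fun k => MeasurableSet.inter ?_ ?_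
  · exact measurableSet_eq_fun (by fun_prop) measurable_const
  · exact measurableSet_le
      (f := fun _ : Arm D × History (Arm D) (outcomeSet D) n => (0 : ℝ))
      (g := fun q => 1 + 2 * m * inner ℝ (q.1 : EuclideanSpace ℝ (Fin D)) (q.2 k).1)
      measurable_const (by fun_prop)

theorem measurableSet_uninformed (m : ℝ) (u : Arm D) (n : ℕ) :
    MeasurableSet (uninformed m u n) :=
  measurable_prodMk_left (measurableSet_uninformed_prod m n)

open scoped Classical in
/-- The mean parameter `m` as long as the agent is uninformed, and a safe one afterwards. -/
def hidingMean (m : ℝ) (u : Arm D) (n : ℕ)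
    (q : History (Arm D) (outcomeSet D) n × Arm D) : ℝ :=
  if q.1 ∈ uninformed m u n ∧ 0 ≤ 1 + 2 * m * inner ℝ (u : EuclideanSpace ℝ (Fin D)) q.2 then m
  else safeMean (inner ℝ (u : EuclideanSpace ℝ (Fin D)) q.2)

theorem measurable_hidingMean (m : ℝ) (u : Arm D) (n : ℕ) : Measurable (hidingMean m u n) := by
  refine Measurable.ite ?_ measurable_const (measurable_safeMean.comp (by fun_prop))
  exact (measurable_fst (measurableSet_uninformed m u n)).inter
    (measurableSet_le (f := fun _ : History (Arm D) (outcomeSet D) n × Arm D => (0 : ℝ))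
      (g := fun q => 1 + 2 * m * inner ℝ (u : EuclideanSpace ℝ (Fin D)) q.2)
      measurable_const (by fun_prop))

theorem hidingMean_mem {m : ℝ} (hm : m ∈ Icc (0 : ℝ) 1) (u : Arm D) (n : ℕ)
    (q : History (Arm D) (outcomeSet D) n × Arm D) : hidingMean m u n q ∈ Icc (0 : ℝ) 1 := by
  unfold hidingMean
  split_ifs
  · exact hm
  · exact safeMean_mem_Icc _

theorem hidingMean_mul_nonneg (m : ℝ) (u : Arm D) (n : ℕ)
    (q : History (Arm D) (outcomeSet D) n × Arm D) :
    0 ≤ 1 + 2 * hidingMean m u n q * inner ℝ (u : EuclideanSpace ℝ (Fin D)) q.2 := by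
  unfold hidingMean
  split_ifs with h
  · exact h.2
  · exact safeMean_mul_nonneg _

/-- Nature reveals nothing but the failure of being `uninformed`. -/
def hidingPolicy {α : ℝ} (hα : α ∈ Ioc (0 : ℝ) (1 / 4)) {m : ℝ} (hm : m ∈ Icc (0 : ℝ) 1)
    (u : Arm D) : NaturePolicy (hypothesis D (paramVec α u)) :=
  threePointPolicy hα u (hidingMean m u) (measurable_hidingMean m u) (hidingMean_mem hm u)
    (hidingMean_mul_nonneg m u)

/-- The reference policy, which does not depend on the hypothesis (and is not compatible with it):
the apex never occurs. -/
def blindPolicy (D : ℕ) {m : ℝ} (hm : m ∈ Icc (0 : ℝ) 1) :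
    NaturePolicy (fun _ : Arm D => (univ : Set (Measure (outcomeSet D)))) where
  kernel n := ⟨fun q => threePoint 0 m q.2,
    measurable_threePoint measurable_const measurable_const measurable_snd⟩
  isMarkovKernel n := ⟨fun q => isProbabilityMeasure_threePoint (by simp) hm _⟩
  compatible _ _ _ := mem_univ _

theorem hidingPolicy_kernel {α : ℝ} (hα : α ∈ Ioc (0 : ℝ) (1 / 4)) {m : ℝ}
    (hm : m ∈ Icc (0 : ℝ) 1) (u : Arm D) (n : ℕ)
    (q : History (Arm D) (outcomeSet D) n × Arm D) :
    (hidingPolicy hα hm u).kernel n q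
      = threePoint (apexProb α u (hidingMean m u n q) q.2) (hidingMean m u n q) q.2 := rfl

theorem blindPolicy_kernel {m : ℝ} (hm : m ∈ Icc (0 : ℝ) 1) (n : ℕ)
    (q : History (Arm D) (outcomeSet D) n × Arm D) :
    (blindPolicy D hm).kernel n q = threePoint 0 m q.2 := rfl

/-- On uninformed histories, the law of the history has a density at least
`((1 - α) / (1 + 2α))ⁿ` with respect to the reference law. -/
theorem mul_lintegral_blindPolicy_le {α : ℝ} (hα : α ∈ Ioc (0 : ℝ) (1 / 4)) {m : ℝ}
    (hm : m ∈ Icc (0 : ℝ) 1) (u : Arm D) (φ : AgentPolicy (Arm D) (outcomeSet D)) (n : ℕ)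
    {f : History (Arm D) (outcomeSet D) n → ℝ≥0∞} (hf : Measurable f) :
    ENNReal.ofReal ((1 - α) / (1 + 2 * α)) ^ n *
        ∫⁻ h, (uninformed m u n).indicator f h ∂(historyLaw φ (blindPolicy D hm) n)
      ≤ ∫⁻ h, f h ∂(historyLaw φ (hidingPolicy hα hm u) n) := by
  induction n with
  | zero =>
    rw [pow_zero, one_mul]
    exact lintegral_mono fun h => indicator_le_self _ _ _
  | succ n ih =>
    set ρ := ENNReal.ofReal ((1 - α) / (1 + 2 * α)) with hρ
    have hind := hf.indicator (measurableSet_uninformed m u (n + 1))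
    rw [lintegral_historyLaw_succ _ _ _ hf, lintegral_historyLaw_succ _ _ _ hind, pow_succ,
      mul_assoc]
    have hg : Measurable fun h : History (Arm D) (outcomeSet D) n =>
        ∫⁻ y, f (Fin.snoc h (φ.act n h, y))
          ∂((hidingPolicy hα hm u).kernel n (h, φ.act n h)) := by
      have h1 : Measurable fun p : (History (Arm D) (outcomeSet D) n × Arm D) × outcomeSet D =>
          f (Fin.snoc p.1.1 (p.1.2, p.2)) :=
        hf.comp ((measurable_snoc n).comp (by fun_prop :
          Measurable fun p : (History (Arm D) (outcomeSet D) n × Arm D) × outcomeSet D =>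
            (p.1.1, (p.1.2, p.2))))
      exact (h1.lintegral_kernel_prod_right' (κ := (hidingPolicy hα hm u).kernel n)).comp
        (measurable_id.prodMk (φ.measurable_act n))
    -- The induction hypothesis is applied to the conditional expectation of `f` given the first `n`
    -- rounds.
    refine le_trans ?_ (ih hg)
    gcongr
    rw [← lintegral_const_mul' _ _ ENNReal.ofReal_ne_top]
    refine lintegral_mono fun h => ?_
    by_cases hh : h ∈ uninformed m u n ∧
        0 ≤ 1 + 2 * m * inner ℝ (u : EuclideanSpace ℝ (Fin D)) (φ.act n h)
    · rw [indicator_of_mem hh.1, hidingPolicy_kernel, blindPolicy_kernel]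
      have hmean : hidingMean m u n (h, φ.act n h) = m := if_pos hh
      simp only [hmean, lintegral_threePoint]
      have hp := le_one_sub_apexProb hα u hm (φ.act n h)
      have hρ0 : 0 ≤ (1 - α) / (1 + 2 * α) :=
        div_nonneg (by linarith [hα.2]) (by linarith [hα.1])
      have hterm : ∀ {b : ℝ} (z : ℝ≥0∞), 0 ≤ b →
          ρ * (ENNReal.ofReal ((1 - 0) * b) * z)
            ≤ ENNReal.ofReal ((1 - apexProb α u m (φ.act n h)) * b) * z := by
        intro b z hb
        rw [← mul_assoc, hρ, ← ENNReal.ofReal_mul hρ0, sub_zero, one_mul]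
        gcongr
      rw [ENNReal.ofReal_zero, zero_mul, zero_add, mul_add, add_assoc]
      -- The apex term of the hiding law is discarded; the two rim terms differ from the blind ones
      -- only by the factor `1 - p`.
      refine le_trans (add_le_add ?_ ?_) le_add_self
      · exact le_trans (by gcongr; exact indicator_le_self _ _ _)
          (hterm _ (by linarith [hm.1]))
      · exact le_trans (by gcongr; exact indicator_le_self _ _ _)
          (hterm _ (by linarith [hm.2]))
    · have : ∀ y, (uninformed m u (n + 1)).indicator f (Fin.snoc h (φ.act n h, y)) = 0 :=
        fun y => indicator_of_notMem (fun hy => hh ⟨(snoc_mem_uninformed.1 hy).1,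
          (snoc_mem_uninformed.1 hy).2.2⟩) _
      simp [this]

theorem pow_mul_blindPolicy_le {α : ℝ} (hα : α ∈ Ioc (0 : ℝ) (1 / 4)) {m : ℝ}
    (hm : m ∈ Icc (0 : ℝ) 1) (u : Arm D) (φ : AgentPolicy (Arm D) (outcomeSet D)) (n : ℕ) :
    ((1 - α) / (1 + 2 * α)) ^ n *
        (historyLaw φ (blindPolicy D hm) n).real (uninformed m u n)
      ≤ (historyLaw φ (hidingPolicy hα hm u) n).real (uninformed m u n) := by
  have hmeas := measurableSet_uninformed m u n
  have h := mul_lintegral_blindPolicy_le hα hm u φ n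
    ((measurable_const (a := (1 : ℝ≥0∞))).indicator hmeas)
  rw [indicator_indicator, inter_self, lintegral_indicator_const hmeas,
    lintegral_indicator_const hmeas, one_mul, one_mul] at h
  have hρ0 : 0 ≤ (1 - α) / (1 + 2 * α) :=
    div_nonneg (by linarith [hα.2]) (by linarith [hα.1])
  have := ENNReal.toReal_mono (measure_ne_top _ _) h
  rwa [ENNReal.toReal_mul, ENNReal.toReal_pow, ENNReal.toReal_ofReal hρ0] at this

theorem measurable_lastReward (n : ℕ) :
    Measurable fun h : History (Arm D) (outcomeSet D) (n + 1) =>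
      reward D (h (Fin.last n)).1 (h (Fin.last n)).2 :=
  measurable_reward.comp (measurable_pi_apply _)

theorem abs_expectedReward_le {H : Arm D → Set (Measure (outcomeSet D))}
    (φ : AgentPolicy (Arm D) (outcomeSet D)) (ν : NaturePolicy H) (n : ℕ) :
    |expectedReward (reward D) φ ν n| ≤ 1 := by
  simpa [expectedReward] using norm_integral_le_of_norm_le_const
    (μ := historyLaw φ ν (n + 1)) (C := 1) (f := fun h : History (Arm D) (outcomeSet D) (n + 1) =>
      reward D (h (Fin.last n)).1 (h (Fin.last n)).2) (ae_of_all _ fun h => abs_reward_le _ _)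

theorem expectedReward_eq {H : Arm D → Set (Measure (outcomeSet D))}
    (φ : AgentPolicy (Arm D) (outcomeSet D)) (ν : NaturePolicy H) (n : ℕ) :
    expectedReward (reward D) φ ν n
      = ∫ h, ∫ y, reward D (φ.act n h) y ∂(ν.kernel n (h, φ.act n h)) ∂(historyLaw φ ν n) := by
  rw [expectedReward, integral_historyLaw_succ φ ν n (measurable_lastReward n)
    fun h => abs_reward_le _ _]
  simp only [Fin.snoc_last]

/-- The loss of a single round against the hiding policy. -/
theorem expectedReward_hidingPolicy_le {α : ℝ} (hα : α ∈ Ioc (0 : ℝ) (1 / 4)) {m : ℝ}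
    (hm : m ∈ Icc (0 : ℝ) 1) (u : Arm D) (φ : AgentPolicy (Arm D) (outcomeSet D)) (n : ℕ) :
    m * (historyLaw φ (hidingPolicy hα hm u) (n + 1)).real (uninformed m u (n + 1))
        - (historyLaw φ (hidingPolicy hα hm u) n).real (uninformed m u n) / 2
      ≤ -(1 / 2) - expectedReward (reward D) φ (hidingPolicy hα hm u) n := by
  set ν := hidingPolicy hα hm u
  have hm1 := measurableSet_uninformed m u (n + 1)
  have hm0 := measurableSet_uninformed m u n
  have hinit : Measurable fun h : History (Arm D) (outcomeSet D) (n + 1) =>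
      (Fin.init h : History (Arm D) (outcomeSet D) n) :=
    measurable_pi_lambda _ fun i => measurable_pi_apply _
  let a : History (Arm D) (outcomeSet D) (n + 1) → ℝ := (uninformed m u (n + 1)).indicator 1
  let b : History (Arm D) (outcomeSet D) n → ℝ := (uninformed m u n).indicator 1
  have ha : Measurable a := measurable_one.indicator hm1
  have hb : Measurable b := measurable_one.indicator hm0
  have ha1 : ∀ h, |a h| ≤ 1 := fun h => by
    by_cases hh : h ∈ uninformed m u (n + 1) <;> simp [a, hh]
  have hb1 : ∀ h, |b h| ≤ 1 := fun h => by
    by_cases hh : h ∈ uninformed m u n <;> simp [b, hh]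
  have hr := measurable_lastReward (D := D) n
  have hint : ∀ {f : History (Arm D) (outcomeSet D) (n + 1) → ℝ}, Measurable f →
      (∀ h, |f h| ≤ 1) → Integrable f (historyLaw φ ν (n + 1)) := fun hf hf1 =>
    Integrable.of_bound hf.aestronglyMeasurable 1 (ae_of_all _ hf1)
  have ia := hint ha ha1
  have hbi : Measurable fun h : History (Arm D) (outcomeSet D) (n + 1) => b (Fin.init h) :=
    hb.comp hinit
  have ib := hint hbi fun h => hb1 _
  have ir := hint hr fun h => abs_reward_le _ _
  have eb : ∫ h, b (Fin.init h) ∂(historyLaw φ ν (n + 1))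
      = (historyLaw φ ν n).real (uninformed m u n) := by
    rw [integral_historyLaw_succ φ ν n hbi fun h => hb1 _]
    simp only [Fin.init_snoc, integral_const, probReal_univ, one_smul]
    exact integral_indicator_one hm0
  have ea : ∫ h, a h ∂(historyLaw φ ν (n + 1))
      = (historyLaw φ ν (n + 1)).real (uninformed m u (n + 1)) := integral_indicator_one hm1
  -- The claim is that this integral is nonnegative; it is checked conditionally on the first `n`
  -- rounds.
  have hF : 0 ≤ ∫ h, (b (Fin.init h) / 2 - 1 / 2 - reward D (h (Fin.last n)).1 (h (Fin.last n)).2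
      - m * a h) ∂(historyLaw φ ν (n + 1)) := by
    rw [integral_historyLaw_succ φ ν n (C := 4)]
    · refine integral_nonneg fun h => ?_
      have hk : ν.kernel n (h, φ.act n h) = threePoint _ _ _ := hidingPolicy_kernel hα hm u n _
      have hp := apexProb_mem hα u (hidingMean_mem hm u n (h, φ.act n h)) _
        (hidingMean_mul_nonneg m u n (h, φ.act n h))
      have hM := hidingMean_mem hm u n (h, φ.act n h)
      simp only [Pi.zero_apply, Fin.init_snoc, Fin.snoc_last]
      rw [hk, integral_threePoint hp hM]
      simp only [reward_apex, reward_rim, reward_rim_neg, smul_eq_mul]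
      by_cases hh : h ∈ uninformed m u n ∧
        0 ≤ 1 + 2 * m * inner ℝ (u : EuclideanSpace ℝ (Fin D)) (φ.act n h)
      · have hmean : hidingMean m u n (h, φ.act n h) = m := if_pos hh
        have hb' : b h = 1 := indicator_of_mem hh.1 _
        have h1 : ∀ x', a (Fin.snoc h (φ.act n h, rim x')) = 1 := fun x' =>
          indicator_of_mem (snoc_mem_uninformed.2 ⟨hh.1, rim_zero _, hh.2⟩) _
        have h2 : a (Fin.snoc h (φ.act n h, apex D)) = 0 :=
          indicator_of_notMem (fun hy => by simpa using (snoc_mem_uninformed.1 hy).2.1) _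
        rw [hmean, hb', h1, h1, h2]
        -- While the agent is uninformed and outside the cap, `1 - p` is both the chance of staying
        -- uninformed and the factor in the reward `-(1 - p) m`, so the terms cancel exactly.
        apply le_of_eq
        ring
      · have hmean : hidingMean m u n (h, φ.act n h) = safeMean _ := if_neg hh
        have h1 : ∀ y, a (Fin.snoc h (φ.act n h, y)) = 0 := fun y =>
          indicator_of_notMem (fun hy => hh ⟨(snoc_mem_uninformed.1 hy).1,
            (snoc_mem_uninformed.1 hy).2.2⟩) _
        have hb' : 0 ≤ b h := indicator_nonneg (fun _ _ => zero_le_one) _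
        have hs := half_le_safeMean hα u (φ.act n h)
        rw [hmean, h1, h1, h1]
        simp only at hs ⊢
        linear_combination hs + hb' / 2
    · exact (((hbi.div_const 2).sub_const _).sub hr).sub (ha.const_mul m)
    · intro h
      have h1 := abs_le.1 (hb1 (Fin.init h))
      have h2 := abs_le.1 (abs_reward_le (h (Fin.last n)).1 (h (Fin.last n)).2)
      have h3 := abs_le.1 (ha1 h)
      rw [abs_le]
      constructor <;> nlinarith [hm.1, hm.2]
  have ic : Integrable (fun h => b (Fin.init h) / 2 - 1 / 2) (historyLaw φ ν (n + 1)) :=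
    (ib.div_const 2).sub (integrable_const _)
  have id : Integrable (fun h => b (Fin.init h) / 2 - 1 / 2 -
      reward D (h (Fin.last n)).1 (h (Fin.last n)).2) (historyLaw φ ν (n + 1)) := ic.sub ir
  rw [integral_sub id (ia.const_mul m), integral_sub ic ir,
    integral_sub (ib.div_const 2) (integrable_const _), integral_div, integral_const_mul, eb, ea]
    at hF
  simp only [integral_const, probReal_univ, one_smul] at hF
  unfold expectedReward
  linarith

/-- Regrouping the round losses leaves the telescoping sum `(ℓ N - ℓ 0)/2 ≥ -1/2`, the source of the
additive constant. -/
theorem sum_expectedReward_hidingPolicy_le {α : ℝ} (hα : α ∈ Ioc (0 : ℝ) (1 / 4)) {m : ℝ}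
    (hm : m ∈ Icc (0 : ℝ) 1) (u : Arm D) (φ : AgentPolicy (Arm D) (outcomeSet D)) (N : ℕ) :
    (m - 1 / 2) * ∑ n ∈ Finset.range N,
        (historyLaw φ (hidingPolicy hα hm u) (n + 1)).real (uninformed m u (n + 1)) - 1 / 2
      ≤ ∑ n ∈ Finset.range N,
        (-(1 / 2) - expectedReward (reward D) φ (hidingPolicy hα hm u) n) := by
  set ℓ : ℕ → ℝ := fun n => (historyLaw φ (hidingPolicy hα hm u) n).real (uninformed m u n)
  have h := Finset.sum_le_sum fun n (_ : n ∈ Finset.range N) =>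
    expectedReward_hidingPolicy_le hα hm u φ n
  refine le_trans ?_ h
  have htel := Finset.sum_range_sub ℓ N
  have h0 : ℓ 0 ≤ 1 := measureReal_le_one
  have hN : 0 ≤ ℓ N := measureReal_nonneg
  have e : ∑ n ∈ Finset.range N, (m * ℓ (n + 1) - ℓ n / 2)
      = (m - 1 / 2) * ∑ n ∈ Finset.range N, ℓ (n + 1)
        + (∑ n ∈ Finset.range N, (ℓ (n + 1) - ℓ n)) / 2 := by
    rw [Finset.mul_sum, Finset.sum_div, ← Finset.sum_add_distrib]
    exact Finset.sum_congr rfl fun n _ => by ring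
  change _ ≤ ∑ n ∈ Finset.range N, (m * ℓ (n + 1) - ℓ n / 2)
  rw [e, htel]
  linarith

theorem sum_le_regret {α : ℝ} (hα : α ∈ Ioc (0 : ℝ) (1 / 4)) (u : Arm D)
    (φ : AgentPolicy (Arm D) (outcomeSet D)) (N : ℕ)
    (ν : NaturePolicy (hypothesis D (paramVec α u))) :
    ∑ n ∈ Finset.range N, (-(1 / 2) - expectedReward (reward D) φ ν n)
      ≤ regret (hypothesis D (paramVec α u)) (reward D) φ N := by
  -- Needed for the real infimum over policies to be a genuine lower bound.
  have hbdd : BddBelow (range fun ν : NaturePolicy (hypothesis D (paramVec α u)) =>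
      ∑ n ∈ Finset.range N, expectedReward (reward D) φ ν n) := by
    refine ⟨∑ n ∈ Finset.range N, (-1), ?_⟩
    rintro _ ⟨ν, rfl⟩
    exact Finset.sum_le_sum fun n _ => (abs_le.1 (abs_expectedReward_le φ ν n)).1
  have h1 := ciInf_le hbdd ν
  have h2 := mul_le_mul_of_nonneg_left (neg_half_le_iSup_lowerPrevision hα u)
    (Nat.cast_nonneg (α := ℝ) N)
  rw [regret, Finset.sum_sub_distrib, Finset.sum_const, Finset.card_range, nsmul_eq_mul]
  linarith

/-! ### Averaging over the hypothesis -/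

/-- A union bound over rounds: without the apex, only an arm in the cap around `-u` ends the
uninformed phase. -/
theorem lintegral_blindPolicy_compl_le [NeZero D] {m : ℝ} (hm : m ∈ Icc (0 : ℝ) 1) {σ : ℝ≥0∞}
    (hσ : ∀ x : Arm D, uniformSphere D
      {u | 1 + 2 * m * inner ℝ (u : EuclideanSpace ℝ (Fin D)) x < 0} ≤ σ)
    (φ : AgentPolicy (Arm D) (outcomeSet D)) (n : ℕ) :
    ∫⁻ u, historyLaw φ (blindPolicy D hm) n (uninformed m u n)ᶜ ∂(uniformSphere D) ≤ n * σ := by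
  induction n with
  | zero =>
    have : ∀ u : Arm D, (uninformed m u 0)ᶜ = ∅ := fun u =>
      compl_empty_iff.2 (eq_univ_of_forall fun h k => k.elim0)
    simp [this]
  | succ n ih =>
    set P := historyLaw φ (blindPolicy D hm) n
    let S : Set (Arm D × History (Arm D) (outcomeSet D) n) :=
      {q | 1 + 2 * m * inner ℝ (q.1 : EuclideanSpace ℝ (Fin D)) (φ.act n q.2) < 0}
    have hact := φ.measurable_act n
    have hS : MeasurableSet S := measurableSet_lt (by fun_prop) measurable_const
    have hstep : ∀ u : Arm D, historyLaw φ (blindPolicy D hm) (n + 1) (uninformed m u (n + 1))ᶜ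
        ≤ P (uninformed m u n)ᶜ + P (Prod.mk u ⁻¹' S) := by
      intro u
      have hmeas := (measurableSet_uninformed m u (n + 1)).compl
      rw [← lintegral_indicator_one hmeas,
        lintegral_historyLaw_succ _ _ _ (measurable_one.indicator hmeas)]
      refine le_trans ?_ (measure_union_le _ _)
      rw [← lintegral_indicator_one ((measurableSet_uninformed m u n).compl.union
        (measurable_prodMk_left hS))]
      refine lintegral_mono fun h => ?_
      by_cases hh : h ∈ (uninformed m u n)ᶜ ∪ Prod.mk u ⁻¹' S
      · have := (blindPolicy D hm).isMarkovKernel n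
        rw [indicator_of_mem hh]
        refine (lintegral_mono (g := fun _ => 1) fun y => ?_).trans (by simp)
        exact indicator_le_self' (fun _ _ => zero_le) _
      · rw [blindPolicy_kernel, lintegral_threePoint]
        simp only [mem_union, mem_compl_iff, mem_preimage, S, mem_ofPred_eq, not_or, not_not,
          not_lt] at hh
        have h1 : ∀ x', (uninformed m u (n + 1))ᶜ.indicator
            (1 : History (Arm D) (outcomeSet D) (n + 1) → ℝ≥0∞)
            (Fin.snoc h (φ.act n h, rim x')) = 0 := fun x' =>
          indicator_of_notMem (not_not.2 (snoc_mem_uninformed.2 ⟨hh.1, rim_zero _, hh.2⟩)) _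
        simp [h1]
    calc ∫⁻ u, historyLaw φ (blindPolicy D hm) (n + 1) (uninformed m u (n + 1))ᶜ
          ∂(uniformSphere D)
        ≤ ∫⁻ u, (P (uninformed m u n)ᶜ + P (Prod.mk u ⁻¹' S)) ∂(uniformSphere D) :=
          lintegral_mono hstep
      _ = ∫⁻ u, P (uninformed m u n)ᶜ ∂(uniformSphere D)
          + ∫⁻ u, P (Prod.mk u ⁻¹' S) ∂(uniformSphere D) :=
          lintegral_add_right _ (measurable_measure_prodMk_left hS)
      _ ≤ n * σ + σ := by
          gcongr
          -- The blind law `P` does not involve `u`, so Fubini allows averaging over `u` with the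
          -- history, hence the arm, held fixed.
          rw [← Measure.prod_apply hS, Measure.prod_apply_symm hS]
          refine (lintegral_mono fun h => hσ (φ.act n h)).trans ?_
          simp
      _ = (n + 1 : ℕ) * σ := by
          push_cast
          ring

theorem measurable_blindPolicy_uninformed {m : ℝ} (hm : m ∈ Icc (0 : ℝ) 1)
    (φ : AgentPolicy (Arm D) (outcomeSet D)) (n : ℕ) :
    Measurable fun u : Arm D =>
      (historyLaw φ (blindPolicy D hm) n).real (uninformed m u n) :=
  (measurable_measure_prodMk_left (measurableSet_uninformed_prod m n)).ennreal_toReal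

theorem integrable_blindPolicy_uninformed [NeZero D] {m : ℝ} (hm : m ∈ Icc (0 : ℝ) 1)
    (φ : AgentPolicy (Arm D) (outcomeSet D)) (n : ℕ) :
    Integrable (fun u : Arm D =>
      (historyLaw φ (blindPolicy D hm) n).real (uninformed m u n)) (uniformSphere D) :=
  Integrable.of_bound (measurable_blindPolicy_uninformed hm φ n).aestronglyMeasurable 1
    (ae_of_all _ fun u => by
      rw [Real.norm_of_nonneg measureReal_nonneg]
      exact measureReal_le_one)

theorem one_sub_le_integral_blindPolicy [NeZero D] {m : ℝ} (hm : m ∈ Icc (0 : ℝ) 1) {σ : ℝ}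
    (hσ0 : 0 ≤ σ) (hσ : ∀ x : Arm D, uniformSphere D
      {u | 1 + 2 * m * inner ℝ (u : EuclideanSpace ℝ (Fin D)) x < 0} ≤ ENNReal.ofReal σ)
    (φ : AgentPolicy (Arm D) (outcomeSet D)) (n : ℕ) :
    1 - n * σ ≤ ∫ u, (historyLaw φ (blindPolicy D hm) n).real (uninformed m u n)
      ∂(uniformSphere D) := by
  have h := ENNReal.toReal_mono (by finiteness) (lintegral_blindPolicy_compl_le hm hσ φ n)
  have hmeas : Measurable fun u : Arm D =>
      historyLaw φ (blindPolicy D hm) n (uninformed m u n)ᶜ :=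
    measurable_measure_prodMk_left (measurableSet_uninformed_prod m n).compl
  rw [← integral_toReal hmeas.aemeasurable (ae_of_all _ fun _ => measure_lt_top _ _),
    ENNReal.toReal_mul, ENNReal.toReal_ofReal hσ0, ENNReal.toReal_natCast] at h
  have e : ∀ u : Arm D, (historyLaw φ (blindPolicy D hm) n (uninformed m u n)ᶜ).toReal
      = 1 - (historyLaw φ (blindPolicy D hm) n).real (uninformed m u n) := fun u =>
    probReal_compl_eq_one_sub (measurableSet_uninformed m u n)
  simp_rw [e] at h
  rw [integral_sub (integrable_const _) (integrable_blindPolicy_uninformed hm φ n)] at h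
  simp at h
  linarith

end

end ConeBandit

/-! ### Lower bounds for the Bayesian regret -/

namespace ConeBandit

open ImpreciseBandit Set Metric

noncomputable section

variable {D : ℕ}

/-- The direction `u` of the parameter vector `(1 - α, -α, 2αu)`. -/
def direction (α : ℝ) (θ : Y D) : EuclideanSpace ℝ (Fin D) :=
  WithLp.toLp 2 fun i => θ i.succ.succ / (2 * α)

theorem direction_paramVec {α : ℝ} (hα : α ≠ 0) (u : EuclideanSpace ℝ (Fin D)) :
    direction α (paramVec α u) = u := by
  ext i
  simp only [direction, paramVec, Matrix.cons_val_succ]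
  field_simp

theorem measurable_direction (α : ℝ) : Measurable (direction α : Y D → _) :=
  (WithLp.measurable_toLp _ _).comp (measurable_pi_lambda _ fun i => by fun_prop)

theorem measurable_paramVec (α : ℝ) :
    Measurable (paramVec α : EuclideanSpace ℝ (Fin D) → Y D) := by
  refine (WithLp.measurable_toLp _ _).comp (measurable_pi_lambda _ ?_)
  intro i
  refine Fin.cases ?_ (fun i => Fin.cases ?_ (fun i => ?_) i) i
  · exact measurable_const
  · exact measurable_const
  · exact (by fun_prop : Measurable fun u : EuclideanSpace ℝ (Fin D) => 2 * α * u i)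

/-- The minorant is carried to the hypothesis set by the inverse of `paramVec`; measurability of the
regret itself is never needed. -/
theorem integral_le_bayesRegret {α : ℝ} (hα : α ≠ 0) (φ : AgentPolicy (Arm D) (outcomeSet D))
    (N : ℕ) {g : Arm D → ℝ} (hg : Measurable g) (hgi : Integrable g (uniformSphere D))
    (hle : ∀ u : Arm D, g u ≤ regret (hypothesis D (paramVec α u)) (reward D) φ N) :
    ((∫ u, g u ∂(uniformSphere D) : ℝ) : EReal) ≤ bayesRegret D α φ N := by
  let P : Arm D → hypothesisSet D α := fun u =>
    ⟨paramVec α u.1, u.1, mem_sphere_zero_iff_norm.1 u.2, rfl⟩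
  have hdir : ∀ θ : hypothesisSet D α, direction α (θ : Y D) ∈ sphere (0 : _) 1 := by
    rintro ⟨_, u, hu, rfl⟩
    rw [direction_paramVec hα]
    exact mem_sphere_zero_iff_norm.2 hu
  let e : hypothesisSet D α → Arm D := fun θ => ⟨direction α (θ : Y D), hdir θ⟩
  have hP : Measurable P := ((measurable_paramVec α).comp measurable_subtype_coe).subtype_mk
  have he : Measurable e := ((measurable_direction α).comp measurable_subtype_coe).subtype_mk
  have heP : ∀ u, e (P u) = u := fun u => Subtype.ext (direction_paramVec hα u.1)
  have hprior : prior D α = (uniformSphere D).map P := rfl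
  have hge := (hg.comp he).aestronglyMeasurable (μ := (uniformSphere D).map P)
  have hint : Integrable (g ∘ e) (prior D α) := by
    rw [hprior, integrable_map_measure hge hP.aemeasurable]
    simpa only [Function.comp_def, heP] using hgi
  have heq : ∫ θ, (g ∘ e) θ ∂(prior D α) = ∫ u, g u ∂(uniformSphere D) := by
    rw [hprior, integral_map hP.aemeasurable hge]
    simp only [Function.comp_def, heP]
  rw [← heq]
  refine le_iSup_of_le (g ∘ e) (le_iSup_of_le hint (le_iSup_of_le ?_ le_rfl))
  rintro ⟨_, u, hu, rfl⟩
  have h := hle ⟨u, mem_sphere_zero_iff_norm.2 hu⟩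
  have heu : e ⟨paramVec α u, u, hu, rfl⟩ = ⟨u, mem_sphere_zero_iff_norm.2 hu⟩ :=
    Subtype.ext (direction_paramVec hα u)
  rw [Function.comp_apply, heu]
  exact h

/-! ### Numerical inequalities for the constants -/

theorem sqrt_two_sub_one_mul_le {w : ℝ} (hw0 : 0 ≤ w) (hw1 : w ≤ 1) :
    (√2 - 1) * w ≤ √(1 + w) - 1 := by
  have h2 : √2 ^ 2 = 2 := Real.sq_sqrt (by norm_num)
  have : 1 + (√2 - 1) * w ≤ √(1 + w) := by
    apply Real.le_sqrt_of_sq_le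
    -- Concavity of the square root: the chord over `[0, 1]` lies below the graph.
    have : (1 + w) - (1 + (√2 - 1) * w) ^ 2 = (√2 - 1) ^ 2 * (w * (1 - w)) := by
      linear_combination -w * h2
    have : 0 ≤ (√2 - 1) ^ 2 * (w * (1 - w)) := by
      have : 0 ≤ 1 - w := by linarith
      positivity
    linarith
  linarith

theorem capConst_le_quarter (hD : 4 ≤ D) : capConst D ≤ 1 / 4 := by
  have hD' : (4 : ℝ) ≤ D := by exact_mod_cast hD
  have hpi := Real.pi_gt_three
  rw [capConst, Real.sqrt_le_left (by norm_num), div_le_iff₀ (by positivity)]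
  nlinarith

theorem inv_sqrt_pi_mul_le (hD : 4 ≤ D) :
    1 / √(Real.pi * (2 * (D : ℝ) - 1)) ≤ 27 / 125 := by
  have hD' : (4 : ℝ) ≤ D := by exact_mod_cast hD
  have hpi := Real.pi_gt_d2
  have : (125 / 27 : ℝ) ≤ √(Real.pi * (2 * (D : ℝ) - 1)) := by
    apply Real.le_sqrt_of_sq_le
    nlinarith
  rw [div_le_iff₀ (by linarith)]
  linarith

theorem two_div_pi_sq_mul_le (hD : 4 ≤ D) :
    2 / Real.pi ^ 2 * (1 - 1 / √(Real.pi * (2 * (D : ℝ) - 1)))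
      ≤ (√2 - 1) / 2 * (1 - capConst D) := by
  have hD' : (4 : ℝ) ≤ D := by exact_mod_cast hD
  have hpi := Real.pi_gt_d4
  set t := 1 / √(Real.pi * (2 * (D : ℝ) - 1)) with ht
  have ht0 : 0 ≤ t := by positivity
  have htle : t ≤ 27 / 125 := inv_sqrt_pi_mul_le hD
  have hpos : 0 < Real.pi * (2 * (D : ℝ) - 1) := mul_pos Real.pi_pos (by linarith)
  -- The squared ratio is `1 + (D - 1)/(2D²)`, at most `35/32 < 1.047²` since `(D - 4)(3D - 4) ≥ 0`.
  -- The gap between `2/π²` and `(√2 - 1)/2` absorbs this loss.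
  have hct : capConst D ≤ 1047 / 1000 * t := by
    rw [capConst, Real.sqrt_le_left (by positivity), mul_pow, ht,
      div_pow (1 : ℝ) (√_), one_pow, Real.sq_sqrt hpos.le, mul_one_div,
      div_le_div_iff₀ (by positivity) hpos]
    nlinarith [mul_nonneg Real.pi_pos.le (mul_nonneg (sub_nonneg.2 hD')
      (show (0 : ℝ) ≤ 3 * D - 4 by linarith)), mul_nonneg Real.pi_pos.le (sq_nonneg (D : ℝ))]
  have hp2 : 2 / Real.pi ^ 2 ≤ 20266 / 100000 := by
    rw [div_le_iff₀ (by positivity)]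
    nlinarith
  have hs : (1.4142 : ℝ) ≤ √2 := Real.le_sqrt_of_sq_le (by norm_num)
  calc 2 / Real.pi ^ 2 * (1 - t) ≤ 20266 / 100000 * (1 - t) := by
        gcongr
        linarith
    _ ≤ 2071 / 10000 * (1 - 1047 / 1000 * t) := by linarith
    _ ≤ (√2 - 1) / 2 * (1 - capConst D) := by
        apply mul_le_mul <;> linarith

theorem sum_one_sub_ge (N : ℕ) {s : ℝ} (hs : 0 ≤ s) :
    N * (1 - s) ≤ ∑ n ∈ Finset.range N, (1 - ((n + 1 : ℕ) : ℝ) * (s * (1 / N))) := by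
  rw [← nsmul_eq_mul, ← Finset.card_range N, ← Finset.sum_const, Finset.card_range]
  refine Finset.sum_le_sum fun n hn => ?_
  have hnN : ((n + 1 : ℕ) : ℝ) ≤ N := by exact_mod_cast Finset.mem_range.1 hn
  have hN : (0 : ℝ) < N := lt_of_lt_of_le (by positivity) hnN
  have : ((n + 1 : ℕ) : ℝ) * (1 / N) ≤ 1 := by
    rw [mul_one_div, div_le_one hN]
    exact hnN
  nlinarith

theorem le_bayesRegret (hD : 4 ≤ D) {α : ℝ} (hα : α ∈ Ioc (0 : ℝ) (1 / 4))
    (φ : AgentPolicy (Arm D) (outcomeSet D)) {N : ℕ} (hN : 0 < N) :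
    ((2 / Real.pi ^ 2 * (1 - 1 / √(Real.pi * (2 * (D : ℝ) - 1))) *
          ((1 - α) / (1 + 2 * α)) ^ N *
          (N : ℝ) ^ (((D : ℝ) - 3) / ((D : ℝ) - 1)) - 1 / 2 : ℝ) : EReal)
        ≤ bayesRegret D α φ N := by
  have : NeZero D := ⟨by omega⟩
  have hD' : (4 : ℝ) ≤ D := by exact_mod_cast hD
  have hN1 : (1 : ℝ) ≤ N := by exact_mod_cast hN
  have hN0 : (0 : ℝ) < N := by linarith
  -- The widest cap, up to constants, that `N` arms still miss with probability bounded below.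
  set τ : ℝ := (N : ℝ) ^ (-1 / ((D : ℝ) - 1)) with hτ
  have hτ0 : 0 ≤ τ := by positivity
  have hτ1 : τ ≤ 1 := Real.rpow_le_one_of_one_le_of_nonpos hN1
    (div_nonpos_of_nonpos_of_nonneg (by norm_num) (by linarith))
  have hτpow : τ ^ (D - 1) = 1 / N := by
    rw [hτ, ← Real.rpow_natCast, ← Real.rpow_mul hN0.le, Nat.cast_sub (by omega), Nat.cast_one,
      div_mul_cancel₀ _ (by linarith), Real.rpow_neg_one, one_div]
  have hτsq : τ ^ 2 * N = (N : ℝ) ^ (((D : ℝ) - 3) / ((D : ℝ) - 1)) := by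
    rw [hτ, ← Real.rpow_natCast, ← Real.rpow_mul hN0.le]
    nth_rewrite 2 [← Real.rpow_one (N : ℝ)]
    rw [← Real.rpow_add hN0]
    congr 1
    have : (D : ℝ) - 1 ≠ 0 := by linarith
    field_simp
    push_cast
    ring
  -- Chosen so that `1 + 2m⟨u, x⟩ < 0` describes exactly the cap of slope `τ`.
  set m : ℝ := √(1 + τ ^ 2) / 2 with hmdef
  have hsq1 : (1 : ℝ) ≤ √(1 + τ ^ 2) := Real.one_le_sqrt.2 (by nlinarith)
  have hsq2 : √(1 + τ ^ 2) ≤ 2 := Real.sqrt_le_left (by norm_num) |>.2 (by nlinarith)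
  have hm : m ∈ Icc (0 : ℝ) 1 := ⟨by positivity, by linarith⟩
  have hmge : (√2 - 1) / 2 * τ ^ 2 ≤ m - 1 / 2 := by
    have := sqrt_two_sub_one_mul_le (sq_nonneg τ) (pow_le_one₀ hτ0 hτ1)
    linarith
  have hm0 : 0 ≤ m - 1 / 2 := by linarith
  set s := capConst D with hs
  have hs0 : 0 ≤ s := capConst_nonneg D
  have hs1 : s ≤ 1 / 4 := capConst_le_quarter hD
  have hσ : ∀ x : Arm D, uniformSphere D
      {u | 1 + 2 * m * inner ℝ (u : EuclideanSpace ℝ (Fin D)) x < 0}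
        ≤ ENNReal.ofReal (s * (1 / N)) := by
    intro x
    rw [← hτpow]
    refine (measure_mono fun u hu => ?_).trans (uniformSphere_cap_le (by omega) x hτ0)
    have hu' : 1 + 2 * m * inner ℝ (u : EuclideanSpace ℝ (Fin D)) x < 0 := hu
    have e : 2 * m = √(1 + τ ^ 2) := by rw [hmdef]; ring
    rw [e] at hu'
    change inner ℝ (u : EuclideanSpace ℝ (Fin D)) x < -(1 / √(1 + τ ^ 2))
    rw [lt_neg, div_lt_iff₀ (by linarith)]
    linarith
  set ρ := (1 - α) / (1 + 2 * α) with hρ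
  have hρ0 : 0 ≤ ρ := div_nonneg (by linarith [hα.2]) (by linarith [hα.1])
  have hρ1 : ρ ≤ 1 := div_le_one_of_le₀ (by linarith [hα.1]) (by linarith [hα.1])
  set q : ℕ → Arm D → ℝ := fun n u =>
    (historyLaw φ (blindPolicy D hm) (n + 1)).real (uninformed m u (n + 1)) with hq
  have hqm : ∀ n, Measurable (q n) := fun n => measurable_blindPolicy_uninformed hm φ (n + 1)
  have hqi : ∀ n, Integrable (q n) (uniformSphere D) := fun n =>
    integrable_blindPolicy_uninformed hm φ (n + 1)
  have hsum : Integrable (fun u => ∑ n ∈ Finset.range N, q n u) (uniformSphere D) :=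
    integrable_finsetSum _ fun n _ => hqi n
  let g : Arm D → ℝ := fun u => (m - 1 / 2) * ρ ^ N * ∑ n ∈ Finset.range N, q n u - 1 / 2
  have hg : Measurable g := by
    have := Finset.measurable_sum (Finset.range N) fun n _ => hqm n
    exact (this.const_mul _).sub_const _
  have hgi : Integrable g (uniformSphere D) := (hsum.const_mul _).sub (integrable_const _)
  have hle : ∀ u : Arm D, g u ≤ regret (hypothesis D (paramVec α u)) (reward D) φ N := by
    intro u
    refine le_trans ?_ ((sum_expectedReward_hidingPolicy_le hα hm u φ N).trans
      (sum_le_regret hα u φ N _))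
    simp only [g]
    rw [mul_assoc, Finset.mul_sum]
    gcongr with n hn
    refine le_trans ?_ (pow_mul_blindPolicy_le hα hm u φ (n + 1))
    -- All survival factors are replaced by the smallest, `ρ ^ N`.
    exact mul_le_mul_of_nonneg_right (pow_le_pow_of_le_one hρ0 hρ1 (Finset.mem_range.1 hn))
      measureReal_nonneg
  refine le_trans (EReal.coe_le_coe_iff.2 ?_) (integral_le_bayesRegret hα.1.ne' φ N hg hgi hle)
  have hint : ∫ u, g u ∂(uniformSphere D) = (m - 1 / 2) * ρ ^ N *
      ∑ n ∈ Finset.range N, ∫ u, q n u ∂(uniformSphere D) - 1 / 2 := by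
    rw [integral_sub (hsum.const_mul _) (integrable_const _), integral_const_mul,
      integral_finsetSum _ fun n _ => hqi n]
    simp
  rw [hint]
  have h1 : (N : ℝ) * (1 - s) ≤ ∑ n ∈ Finset.range N, ∫ u, q n u ∂(uniformSphere D) :=
    (sum_one_sub_ge N hs0).trans (Finset.sum_le_sum fun n _ =>
      one_sub_le_integral_blindPolicy hm (by positivity) hσ φ (n + 1))
  have h2 := two_div_pi_sq_mul_le hD
  have hρN : 0 ≤ ρ ^ N := pow_nonneg hρ0 N
  have hpow : 0 ≤ (N : ℝ) ^ (((D : ℝ) - 3) / ((D : ℝ) - 1)) := by positivity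
  refine sub_le_sub_right ?_ _
  calc _ ≤ (√2 - 1) / 2 * (1 - s) * ρ ^ N * (N : ℝ) ^ (((D : ℝ) - 3) / ((D : ℝ) - 1)) :=
        mul_le_mul_of_nonneg_right (mul_le_mul_of_nonneg_right h2 hρN) hpow
    _ = ((√2 - 1) / 2 * τ ^ 2) * ρ ^ N * (N * (1 - s)) := by
        rw [← hτsq]
        ring
    _ ≤ (m - 1 / 2) * ρ ^ N * (N * (1 - s)) := by
        have : 0 ≤ 1 - s := by linarith
        gcongr
    _ ≤ _ := mul_le_mul_of_nonneg_left h1 (mul_nonneg hm0 hρN)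

/-- The nature policy that always plays the safe three-point distribution. -/
def safePolicy {α : ℝ} (hα : α ∈ Ioc (0 : ℝ) (1 / 4)) (u : Arm D) :
    NaturePolicy (hypothesis D (paramVec α u)) :=
  threePointPolicy hα u (fun _ q => safeMean (inner ℝ (u : EuclideanSpace ℝ (Fin D)) q.2))
    (fun _ => measurable_safeMean.comp (by fun_prop)) (fun _ _ => safeMean_mem_Icc _)
    (fun _ _ => safeMean_mul_nonneg _)

theorem expectedReward_safePolicy_le {α : ℝ} (hα : α ∈ Ioc (0 : ℝ) (1 / 4)) (u : Arm D)
    (φ : AgentPolicy (Arm D) (outcomeSet D)) (n : ℕ) {b : ℝ}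
    (hb : ∀ h : History (Arm D) (outcomeSet D) n,
      b ≤ (1 - apexProb α u (safeMean (inner ℝ (u : EuclideanSpace ℝ (Fin D)) (φ.act n h)))
        (φ.act n h)) * safeMean (inner ℝ (u : EuclideanSpace ℝ (Fin D)) (φ.act n h))) :
    expectedReward (reward D) φ (safePolicy hα u) n ≤ -b := by
  have hin : ∀ h : History (Arm D) (outcomeSet D) n,
      ∫ y, reward D (φ.act n h) y ∂((safePolicy hα u).kernel n (h, φ.act n h))
        = -((1 - apexProb α u (safeMean (inner ℝ (u : EuclideanSpace ℝ (Fin D)) (φ.act n h)))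
        (φ.act n h)) * safeMean (inner ℝ (u : EuclideanSpace ℝ (Fin D)) (φ.act n h))) := fun h =>
    integral_reward_threePoint (apexProb_mem hα u (safeMean_mem_Icc _) _ (safeMean_mul_nonneg _))
      (safeMean_mem_Icc _) _
  rw [expectedReward_eq]
  simp_rw [hin]
  have hact := φ.measurable_act n
  have hsm : Measurable fun h => safeMean (inner ℝ (u : EuclideanSpace ℝ (Fin D)) (φ.act n h)) :=
    measurable_safeMean.comp (by fun_prop)
  refine (integral_mono (g := fun _ => -b) ?_ (integrable_const _) fun h =>
    neg_le_neg (hb h)).trans (by simp)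
  refine Integrable.of_bound (Measurable.aestronglyMeasurable ?_) 1 (ae_of_all _ fun h => ?_)
  · unfold apexProb
    exact Measurable.neg (by fun_prop)
  · have hp := apexProb_mem hα u (safeMean_mem_Icc _) (φ.act n h) (safeMean_mul_nonneg _)
    have hs := safeMean_mem_Icc (inner ℝ (u : EuclideanSpace ℝ (Fin D)) (φ.act n h))
    have h1 := sub_nonneg.2 hp.2
    rw [norm_neg, Real.norm_of_nonneg (mul_nonneg h1 hs.1)]
    exact mul_le_one₀ (by linarith [hp.1]) hs.1 hs.2

theorem const_le_bayesRegret (hD : 4 ≤ D) {α : ℝ} (hα : α ∈ Ioc (0 : ℝ) (1 / 4))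
    (φ : AgentPolicy (Arm D) (outcomeSet D)) {N : ℕ} (hN : 0 < N) :
    ((1 / 40 : ℝ) : EReal) ≤ bayesRegret D α φ N := by
  have : NeZero D := ⟨by omega⟩
  -- The first arm precedes every outcome, so it is the same for all `u`; at least half of the
  -- directions `u` are far from both `x` and `-x`, and each of them costs `1/20`.
  set x : Arm D := φ.act 0 Fin.elim0 with hx
  let S : Set (Arm D) := {u | |inner ℝ (u : EuclideanSpace ℝ (Fin D)) x| ≤ 1 / √2}
  have hS : MeasurableSet S := measurableSet_le (by fun_prop) measurable_const
  have hle : ∀ u : Arm D, S.indicator (fun _ => (1 / 20 : ℝ)) u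
      ≤ regret (hypothesis D (paramVec α u)) (reward D) φ N := by
    intro u
    refine le_trans ?_ (sum_le_regret hα u φ N (safePolicy hα u))
    have hterm : ∀ n, 0 ≤ -(1 / 2) - expectedReward (reward D) φ (safePolicy hα u) n := by
      intro n
      have := expectedReward_safePolicy_le hα u φ n fun h => half_le_safeMean hα u (φ.act n h)
      linarith
    refine le_trans ?_ (Finset.single_le_sum (fun n _ => hterm n) (Finset.mem_range.2 hN))
    by_cases hu : u ∈ S
    · rw [indicator_of_mem hu]
      have := expectedReward_safePolicy_le hα u φ 0 (b := 1 / 2 + 1 / 20) fun h => by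
        rw [Subsingleton.elim h Fin.elim0]
        exact half_add_le_safeMean hα u x hu
      linarith
    · rw [indicator_of_notMem hu]
      exact hterm 0
  refine le_trans (EReal.coe_le_coe_iff.2 ?_) (integral_le_bayesRegret hα.1.ne' φ N
    (measurable_const.indicator hS) ((integrable_const _).indicator hS) hle)
  have hcap : ∀ z : Arm D, (uniformSphere D).real
      {u | inner ℝ (u : EuclideanSpace ℝ (Fin D)) z < -(1 / √2)} ≤ 1 / 4 := by
    intro z
    have h := uniformSphere_cap_le (by omega) z zero_le_one
    have e : (1 : ℝ) + 1 ^ 2 = 2 := by norm_num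
    rw [e, one_pow, mul_one] at h
    exact (ENNReal.toReal_le_of_le_ofReal (capConst_nonneg D) h).trans (capConst_le_quarter hD)
  have hSc : (uniformSphere D).real Sᶜ ≤ 1 / 2 := by
    calc (uniformSphere D).real Sᶜ
        ≤ (uniformSphere D).real ({u | inner ℝ (u : EuclideanSpace ℝ (Fin D)) x < -(1 / √2)} ∪
          {u | inner ℝ (u : EuclideanSpace ℝ (Fin D)) (-x : Arm D) < -(1 / √2)}) := by
          refine measureReal_mono fun u hu => ?_
          have hu' : 1 / √2 < |inner ℝ (u : EuclideanSpace ℝ (Fin D)) x| := not_le.1 hu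
          rcases lt_abs.1 hu' with h | h
          · right
            change inner ℝ (u : EuclideanSpace ℝ (Fin D)) ((-x : Arm D) : _) < _
            rw [coe_neg_sphere, inner_neg_right]
            linarith
          · left
            change inner ℝ (u : EuclideanSpace ℝ (Fin D)) x < _
            linarith
      _ ≤ 1 / 4 + 1 / 4 := (measureReal_union_le _ _).trans (add_le_add (hcap x) (hcap (-x)))
      _ = 1 / 2 := by norm_num
  rw [probReal_compl_eq_one_sub hS] at hSc
  rw [integral_indicator_const _ hS, smul_eq_mul]
  linarith

/-- By the quadratic Taylor bound, `exp(3α)(1 - α)` exceeds `1 + 2α` by at least `(3/2) α² (1 -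
3α)`. -/
theorem exp_neg_three_mul_le {α : ℝ} (hα : α ∈ Ioc (0 : ℝ) (1 / 4)) :
    Real.exp (-3 * α) ≤ (1 - α) / (1 + 2 * α) := by
  obtain ⟨h0, h1⟩ := hα
  have h := Real.quadratic_le_exp_of_nonneg (x := 3 * α) (by linarith)
  have e : Real.exp (-3 * α) = (Real.exp (3 * α))⁻¹ := by rw [← Real.exp_neg]; ring_nf
  rw [e, le_div_iff₀ (by linarith), inv_mul_le_iff₀ (Real.exp_pos _)]
  have : (1 + 3 * α + (3 * α) ^ 2 / 2) * (1 - α) ≤ Real.exp (3 * α) * (1 - α) :=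
    mul_le_mul_of_nonneg_right h (by linarith)
  nlinarith [mul_nonneg (sq_nonneg α) (show 0 ≤ 1 - 3 * α by linarith)]

theorem exp_mul_le_bayesRegret (hD : 4 ≤ D) {α : ℝ} (hα : α ∈ Ioc (0 : ℝ) (1 / 4))
    (φ : AgentPolicy (Arm D) (outcomeSet D)) {N : ℕ} (hN : 0 < N) :
    ((1 / 210 * Real.exp (-3 * α * N) * (N : ℝ) ^ (((D : ℝ) - 3) / ((D : ℝ) - 1)) : ℝ) : EReal)
      ≤ bayesRegret D α φ N := by
  set M := (N : ℝ) ^ (((D : ℝ) - 3) / ((D : ℝ) - 1)) with hM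
  have hM0 : 0 ≤ M := by positivity
  -- At the threshold `21/4` both regimes are tight: `(1/210)(21/4) = 1/40` and `(1/10 -
  -- 1/210)(21/4) = 1/2`.
  rcases le_total (Real.exp (-3 * α * N) * M) (21 / 4) with h | h
  · refine le_trans (EReal.coe_le_coe_iff.2 ?_) (const_le_bayesRegret hD hα φ hN)
    linarith
  · refine le_trans (EReal.coe_le_coe_iff.2 ?_) (le_bayesRegret hD hα φ hN)
    have ht := inv_sqrt_pi_mul_le hD
    have hk : 1 / 10 ≤ 2 / Real.pi ^ 2 * (1 - 1 / √(Real.pi * (2 * (D : ℝ) - 1))) := by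
      have hpi : 1 / 5 ≤ 2 / Real.pi ^ 2 := by
        rw [div_le_div_iff₀ (by norm_num) (by positivity)]
        nlinarith [Real.pi_lt_d2, Real.pi_pos]
      calc (1 : ℝ) / 10 ≤ 1 / 5 * (1 - 27 / 125) := by norm_num
        _ ≤ _ := by gcongr
    have he : Real.exp (-3 * α * N) ≤ ((1 - α) / (1 + 2 * α)) ^ N := by
      rw [mul_comm (-3 * α), Real.exp_nat_mul]
      exact pow_le_pow_left₀ (Real.exp_pos _).le (exp_neg_three_mul_le hα) N
    have : 1 / 10 * Real.exp (-3 * α * N) * M ≤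
        2 / Real.pi ^ 2 * (1 - 1 / √(Real.pi * (2 * (D : ℝ) - 1))) *
          ((1 - α) / (1 + 2 * α)) ^ N * M := by
      have := Real.exp_pos (-3 * α * N)
      have h10 := (show (0 : ℝ) ≤ 1 / 10 by norm_num).trans hk
      gcongr
    linarith

end

end ConeBandit

theorem theorem5 :
    (∀ (D : ℕ) (_ : 4 ≤ D) (α : ℝ) (_ : α ∈ Set.Ioc (0 : ℝ) (1 / 4))
      (φ : ImpreciseBandit.AgentPolicy (ConeBandit.Arm D) (ConeBandit.outcomeSet D))
      (N : ℕ) (_ : 0 < N),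
      ((2 / Real.pi ^ 2 * (1 - 1 / √(Real.pi * (2 * (D : ℝ) - 1))) *
          ((1 - α) / (1 + 2 * α)) ^ N *
          (N : ℝ) ^ (((D : ℝ) - 3) / ((D : ℝ) - 1)) - 1 / 2 : ℝ) : EReal)
        ≤ ConeBandit.bayesRegret D α φ N) ∧
    (∃ c : ℝ, 0 < c ∧
      ∀ (D : ℕ) (_ : 4 ≤ D) (α : ℝ) (_ : α ∈ Set.Ioc (0 : ℝ) (1 / 4))
        (φ : ImpreciseBandit.AgentPolicy (ConeBandit.Arm D) (ConeBandit.outcomeSet D))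
        (N : ℕ) (_ : 0 < N),
        ((c * Real.exp (-3 * α * N) *
            (N : ℝ) ^ (((D : ℝ) - 3) / ((D : ℝ) - 1)) : ℝ) : EReal)
          ≤ ConeBandit.bayesRegret D α φ N) :=
  ⟨fun _ hD _ hα φ _ hN => ConeBandit.le_bayesRegret hD hα φ hN,
    1 / 210, by norm_num, fun _ hD _ hα φ _ hN => ConeBandit.exp_mul_le_bayesRegret hD hα φ hN⟩
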